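/- **Setting.** Let $n\ge 2$ and let $\bar M=M\cup\partial M$ be a compact complex manifold of complex dimension $n$ with complex structure $J$ and $C^2$ boundary (that is, $\bar M$ has holomorphic charts up to the boundary, with values in closed sides of $C^2$ real hypersurfaces of $\mathbb C^n$, whose coordinate changes are holomorphic and smooth up to the boundary). Suppose that $\partial M$ is Levi flat: the Levi form $\sum\rho_{i\bar j}\xi_i\bar\xi_j$ of a local $C^2$ defining function $\rho$ vanishes on the $(1,0)$-vectors tangent to $\partial M$. Let $\omega=\sqrt{-1}g_{i\bar j}dz^i\wedge d\bar z^j$ be the Kähler form of a smooth Hermitian metric on $\bar M$, with metric tensor $g(X,Y)=\omega(X,JY)$ extended complex bilinearly, and let $\chi=\sqrt{-1}\chi_{i\bar j}dz^i\wedge d\bar z^j$ be a smooth real $(1,1)$-form on $\bar M$. For a real function $u$ put $\mathfrak g[u]=\chi+\sqrt{-1}\partial\bar\partial u$, and let $\lambda(\mathfrak g[u])=(\lambda_1,\dots,\lambda_n)$ be its eigenvalues with respect to $\omega$. Let $\Gamma\subset\mathbb R^n$ be an open symmetric convex cone with vertex at the origin, $\partial\Gamma\ne\emptyset$ and $\Gamma_n\subseteq\Gamma\subseteq\Gamma_1$,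 where $\Gamma_n=\{\lambda:\text{ all }\lambda_i>0\}$ and $\Gamma_1=\{\lambda:\sum_i\lambda_i>0\}$. Let $f$ be a smooth symmetric concave function on $\Gamma$ with $\partial f/\partial\lambda_i>0$ for all $i$. Let $\mathcal K\subset\Gamma$ be compact. **Proposition.** There is a constant $C>0$, depending only on $(\bar M,J,\omega)$, $\chi$, $\Gamma$, $f$ and $\mathcal K$, such that the following holds. Let $\psi\in C^0(\bar M)$ satisfy $$\delta_{\psi,f}:=\inf_{\bar M}\psi-\sup_{\lambda_0\in\partial\Gamma}\limsup_{\lambda\to\lambda_0}f(\lambda)>0,$$ and let $\varphi$ be a real function on $\partial M$. Let $\underline u\in C^2(\bar M)$ be an admissible subsolution with eigenvalues in $\mathcal K$: $$\lambda(\mathfrak g[\underline u])\in\mathcal K \text{ (in some order) on }\bar M,\qquad f(\lambda(\mathfrak g[\underline u]))\ge\psi\text{ in }M,\qquad \underline u=\varphi\text{ on }\partial M.$$ Let $u\in C^3(M)\cap C^2(\bar M)$ be an admissible solution of the Dirichlet problem: $$\lambda(\mathfrak g[u])\in\Gamma\text{ and } f(\lambda(\mathfrak g[u]))=\psi\text{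 in }M,\qquad u=\varphi\text{ on }\partial M.$$ Let $p_0\in\partial M$, let $\nu$ be the unit inner normal vector of $\partial M$ at $p_0$, and put $\xi_n=\frac12(\nu-\sqrt{-1}J\nu)$. Let $\xi_1,\dots,\xi_{n-1}$ be complexified tangent vectors at $p_0$ lying in $T_{\partial M}\cap JT_{\partial M}$, with $J\xi_\alpha=\sqrt{-1}\,\xi_\alpha$ and $g(\xi_\alpha,\bar\xi_\beta)=\delta_{\alpha\beta}$. Then, with $\mathfrak g=\mathfrak g[u]$, $$\mathfrak g(\xi_n,J\bar\xi_n)(p_0)\le C\Big(1+\sum_{\alpha=1}^{n-1}\big|\mathfrak g(\xi_\alpha,J\bar\xi_n)(p_0)\big|^2\Big).$$ In particular $C$ does not depend on $\psi$, $\varphi$, $u$ (hence not on $\sup_M|\nabla u|$ nor on $\delta_{\psi,f}^{-1}$), and it depends on $\underline u$ only through the compact set $\mathcal K$. For a fixed $\underline u$ one may take $\mathcal K$ to be the (compact) set of all orderings of $\lambda(\mathfrak g[\underline u])$ at the points of $\bar M$; more generally, a bound for $|\underline u|_{C^2(\bar M)}$ together with a lower bound for the distance of $\lambda(\mathfrak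 g[\underline u])$ to $\partial\Gamma$ provides such a $\mathcal K$. -/

import Mathlib

open Set Filter Topology
open scoped ContDiff ComplexOrder

noncomputable section

namespace LeviFlatDirichlet

/-- Complex coordinate space. A real vector `∑ (xᵢ ∂/∂xᵢ + yᵢ ∂/∂yᵢ)` is identified with the point
`(xᵢ + √-1 yᵢ)ᵢ`. -/
abbrev CSpace (n : ℕ) : Type := Fin n → ℂ

/-! ### Manifolds with boundary -/

/-- `ρ` is a `C²` defining function of `S` near `z`: near `z` the set `S` is `{ρ ≤ 0}`, and `dρ` does
not vanish on `{ρ = 0}`. (Near an interior point of `S` the function `ρ = -1` will do.) -/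
def IsLocalDefiningFunction {n : ℕ} (S : Set (CSpace n)) (z : CSpace n) (ρ : CSpace n → ℝ) : Prop :=
  ∃ V : Set (CSpace n), IsOpen V ∧ z ∈ V ∧ ContDiffOn ℝ 2 ρ V ∧ S ∩ V = {w ∈ V | ρ w ≤ 0} ∧
    ∀ w ∈ V, ρ w = 0 → fderiv ℝ ρ w ≠ 0

/-- A complex manifold `M̄ = M ∪ ∂M` of complex dimension `n` with `C²` boundary, given by an atlas of
holomorphic charts up to the boundary: each chart is a homeomorphism from an open subset of `M̄` onto
a subset of `ℂⁿ` which is locally open or one closed side of a `C²` real hypersurface; the changes of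
coordinates are holomorphic, and smooth up to the boundary. -/
structure ComplexManifoldWithBoundary (n : ℕ) (M : Type*) [TopologicalSpace M] where
  atlas : Set (PartialEquiv M (CSpace n))
  cover : ∀ p : M, ∃ e ∈ atlas, p ∈ e.source
  isOpen_source : ∀ e ∈ atlas, IsOpen e.source
  continuousOn_coord : ∀ e ∈ atlas, ContinuousOn e e.source
  continuousOn_symm : ∀ e ∈ atlas, ContinuousOn e.symm e.target
  c2_boundary : ∀ e ∈ atlas, ∀ z ∈ e.target, ∃ ρ, IsLocalDefiningFunction e.target z ρ
  holomorphic : ∀ e ∈ atlas, ∀ e' ∈ atlas,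
    ContDiffOn ℂ ∞ (e' ∘ e.symm) (e.symm.trans e').source

/-! ### Complexified tangent vectors in a chart -/

/-- Complexified tangent vectors in a chart: `(a, b)` is `∑ aᵢ ∂/∂zᵢ + ∑ bᵢ ∂/∂z̄ᵢ`. -/
abbrev CTangent (n : ℕ) : Type := CSpace n × CSpace n

/-- The complex structure `J`, extended `ℂ`-linearly. -/
def J {n : ℕ} (X : CTangent n) : CTangent n := (Complex.I • X.1, -Complex.I • X.2)

/-- Complex conjugation `X ↦ X̄`. -/
def conjVec {n : ℕ} (X : CTangent n) : CTangent n := (star X.2, star X.1)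

/-- A real tangent vector, as a complexified one. -/
def ofReal {n : ℕ} (v : CSpace n) : CTangent n := (v, star v)

/-- The value at `(X, Y)` of the 2-form `√-1 ∑ Gᵢⱼ dzᵢ ∧ dz̄ⱼ`. -/
def form {n : ℕ} (G : Matrix (Fin n) (Fin n) ℂ) (X Y : CTangent n) : ℂ :=
  Complex.I * ∑ i, ∑ j, G i j * (X.1 i * Y.2 j - Y.1 i * X.2 j)

/-- The differential at `z` of a real function, extended `ℂ`-linearly:
`X ↦ ∑ (∂ρ/∂zᵢ) aᵢ + ∑ (∂ρ/∂z̄ᵢ) bᵢ`. -/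
def dC {n : ℕ} (ρ : CSpace n → ℝ) (z : CSpace n) (X : CTangent n) : ℂ :=
  ∑ i, (((fderiv ℝ ρ z (Pi.single i 1) : ℂ)
            - Complex.I * (fderiv ℝ ρ z (Pi.single i Complex.I) : ℂ)) / 2 * X.1 i
      + ((fderiv ℝ ρ z (Pi.single i 1) : ℂ)
            + Complex.I * (fderiv ℝ ρ z (Pi.single i Complex.I) : ℂ)) / 2 * X.2 i)

/-- The second real derivative (up to the boundary of `S`) of `v` at `z` in the directions `a`, `b`. -/
def secondDeriv {n : ℕ} (v : CSpace n → ℝ) (S : Set (CSpace n)) (z a b : CSpace n) : ℝ :=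
  fderivWithin ℝ (fun y => fderivWithin ℝ v S y) S z a b

/-- The complex Hessian `∂²v/∂zᵢ∂z̄ⱼ`, where `∂/∂zᵢ = (∂/∂xᵢ - √-1 ∂/∂yᵢ)/2` and
`∂/∂z̄ⱼ = (∂/∂xⱼ + √-1 ∂/∂yⱼ)/2`. -/
def complexHessian {n : ℕ} (v : CSpace n → ℝ) (S : Set (CSpace n)) (z : CSpace n) :
    Matrix (Fin n) (Fin n) ℂ := Matrix.of fun i j =>
  (((secondDeriv v S z (Pi.single i 1) (Pi.single j 1)
      + secondDeriv v S z (Pi.single i Complex.I) (Pi.single j Complex.I) : ℝ) : ℂ)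
    + Complex.I * ((secondDeriv v S z (Pi.single i 1) (Pi.single j Complex.I)
      - secondDeriv v S z (Pi.single i Complex.I) (Pi.single j 1) : ℝ) : ℂ)) / 4

namespace ComplexManifoldWithBoundary

variable {n : ℕ} {M : Type*} [TopologicalSpace M]

/-- The boundary `∂M`. -/
def boundary (X : ComplexManifoldWithBoundary n M) : Set M :=
  {p | ∃ e ∈ X.atlas, p ∈ e.source ∧ e p ∉ interior e.target}

/-- The interior `M = M̄ \ ∂M`. -/
def inner (X : ComplexManifoldWithBoundary n M) : Set M := X.boundaryᶜ

/-- `u ∈ C^k(M̄)`: of class `C^k` up to the boundary. -/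
def IsCk (X : ComplexManifoldWithBoundary n M) (k : ℕ) (u : M → ℝ) : Prop :=
  ∀ e ∈ X.atlas, ContDiffOn ℝ k (u ∘ e.symm) e.target

/-- `u ∈ C^k(M)`: of class `C^k` in the interior. -/
def IsCkInner (X : ComplexManifoldWithBoundary n M) (k : ℕ) (u : M → ℝ) : Prop :=
  ∀ e ∈ X.atlas, ContDiffOn ℝ k (u ∘ e.symm) (interior e.target)

/-- A smooth real `(1,1)`-form `√-1 ∑ χᵢⱼ dzᵢ ∧ dz̄ⱼ` on `M̄`: a smooth Hermitian matrix of
coefficients in each chart, with the transformation law of a `(1,1)`-form. -/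
structure RealOneOneForm (X : ComplexManifoldWithBoundary n M) where
  coeff : PartialEquiv M (CSpace n) → CSpace n → Matrix (Fin n) (Fin n) ℂ
  isHermitian : ∀ e ∈ X.atlas, ∀ z ∈ e.target, (coeff e z).IsHermitian
  smooth : ∀ e ∈ X.atlas, ∀ i j, ContDiffOn ℝ ∞ (fun z => coeff e z i j) e.target
  transform : ∀ e ∈ X.atlas, ∀ e' ∈ X.atlas, ∀ z ∈ (e.symm.trans e').source, ∀ i j,
    coeff e z i j = ∑ k, ∑ l, coeff e' (e' (e.symm z)) k l
      * fderivWithin ℂ (e' ∘ e.symm) (e.symm.trans e').source z (Pi.single i 1) k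
      * star (fderivWithin ℂ (e' ∘ e.symm) (e.symm.trans e').source z (Pi.single j 1) l)

/-- A Hermitian metric on `M̄`, given by its Kähler form `ω = √-1 ∑ gᵢⱼ dzᵢ ∧ dz̄ⱼ`. -/
structure HermitianMetric (X : ComplexManifoldWithBoundary n M) extends RealOneOneForm X where
  posDef : ∀ e ∈ X.atlas, ∀ z ∈ e.target, (coeff e z).PosDef

/-- The metric tensor `g(X, Y) = ω(X, JY)` at the point with coordinate `z` in the chart `e`, extended
`ℂ`-bilinearly to complexified tangent vectors; `g(∂/∂zᵢ, ∂/∂z̄ⱼ) = gᵢⱼ`. -/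
def HermitianMetric.tensor {X : ComplexManifoldWithBoundary n M} (g : X.HermitianMetric)
    (e : PartialEquiv M (CSpace n)) (z : CSpace n) (Y Z : CTangent n) : ℂ :=
  form (g.coeff e z) Y (J Z)

/-- The coefficients `χᵢⱼ + ∂²u/∂zᵢ∂z̄ⱼ` of `𝔤[u] = χ + √-1 ∂∂̄u` in the chart `e`. -/
def RealOneOneForm.deform {X : ComplexManifoldWithBoundary n M} (χ : X.RealOneOneForm) (u : M → ℝ)
    (e : PartialEquiv M (CSpace n)) (z : CSpace n) : Matrix (Fin n) (Fin n) ℂ :=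
  χ.coeff e z + complexHessian (u ∘ e.symm) e.target z

/-- `l` lists, with multiplicity and in some order, the eigenvalues of `𝔤[u]` with respect to `ω`
at `p`. -/
def IsEigenvalues (X : ComplexManifoldWithBoundary n M) (g : X.HermitianMetric)
    (χ : X.RealOneOneForm) (u : M → ℝ) (p : M) (l : Fin n → ℝ) : Prop :=
  ∀ e ∈ X.atlas, p ∈ e.source →
    ((g.coeff e (e p))⁻¹ * χ.deform u e (e p)).charpoly
      = ∏ i, (Polynomial.X - Polynomial.C (l i : ℂ))

/-- The complexified tangent vector `ξ` at `p ∈ ∂M` lies in `T_{∂M} ∩ J T_{∂M}`. -/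
def InComplexTangent (_X : ComplexManifoldWithBoundary n M) (e : PartialEquiv M (CSpace n)) (p : M)
    (ξ : CTangent n) : Prop :=
  ∃ ρ, IsLocalDefiningFunction e.target (e p) ρ ∧ dC ρ (e p) ξ = 0 ∧ dC ρ (e p) (J ξ) = 0

/-- The boundary is Levi flat: the Levi form `∑ ρᵢⱼ ξᵢ ξ̄ⱼ` of a defining function vanishes on the
vectors of type `(1,0)` tangent to the boundary. -/
def IsLeviFlat (X : ComplexManifoldWithBoundary n M) : Prop :=
  ∀ p ∈ X.boundary, ∀ e ∈ X.atlas, p ∈ e.source →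
    ∃ ρ, IsLocalDefiningFunction e.target (e p) ρ ∧
      ∀ ξ : CTangent n, J ξ = Complex.I • ξ → dC ρ (e p) ξ = 0 →
        form (complexHessian ρ univ (e p)) ξ (J (conjVec ξ)) = 0

/-- The real tangent vector `ν` is the unit inner normal of `∂M` at `p`. -/
def IsUnitInnerNormal (X : ComplexManifoldWithBoundary n M) (g : X.HermitianMetric)
    (e : PartialEquiv M (CSpace n)) (p : M) (ν : CSpace n) : Prop :=
  ∃ ρ, IsLocalDefiningFunction e.target (e p) ρ ∧ fderiv ℝ ρ (e p) ν < 0 ∧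
    (∀ τ : CSpace n, fderiv ℝ ρ (e p) τ = 0 → g.tensor e (e p) (ofReal ν) (ofReal τ) = 0) ∧
    g.tensor e (e p) (ofReal ν) (ofReal ν) = 1

/-! ### The Dirichlet problem -/

/-- `u` is admissible: `λ(𝔤[u]) ∈ Γ` in `M`. -/
def IsAdmissible (X : ComplexManifoldWithBoundary n M) (g : X.HermitianMetric)
    (χ : X.RealOneOneForm) (Γ : Set (Fin n → ℝ)) (u : M → ℝ) : Prop :=
  ∀ p ∈ X.inner, ∃ l ∈ Γ, X.IsEigenvalues g χ u p l

/-- `u ∈ C³(M) ∩ C²(M̄)` is an admissible solution of `f(λ(𝔤[u])) = ψ` in `M`, `u = φ` on `∂M`. -/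
structure IsSolution (X : ComplexManifoldWithBoundary n M) (g : X.HermitianMetric)
    (χ : X.RealOneOneForm) (Γ : Set (Fin n → ℝ)) (f : (Fin n → ℝ) → ℝ) (ψ φ u : M → ℝ) : Prop where
  c3 : X.IsCkInner 3 u
  c2 : X.IsCk 2 u
  admissible : X.IsAdmissible g χ Γ u
  equation : ∀ p ∈ X.inner, ∀ l ∈ Γ, X.IsEigenvalues g χ u p l → f l = ψ p
  boundary_value : ∀ p ∈ X.boundary, u p = φ p

/-- `v ∈ C²(M̄)` is an admissible subsolution: `f(λ(𝔤[v])) ≥ ψ` in `M`, `v = φ` on `∂M`. -/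
structure IsSubsolution (X : ComplexManifoldWithBoundary n M) (g : X.HermitianMetric)
    (χ : X.RealOneOneForm) (Γ : Set (Fin n → ℝ)) (f : (Fin n → ℝ) → ℝ) (ψ φ v : M → ℝ) : Prop where
  c2 : X.IsCk 2 v
  admissible : X.IsAdmissible g χ Γ v
  inequality : ∀ p ∈ X.inner, ∀ l ∈ Γ, X.IsEigenvalues g χ v p l → ψ p ≤ f l
  boundary_value : ∀ p ∈ X.boundary, v p = φ p

end ComplexManifoldWithBoundary

/-! ### The cone and the function -/

/-- `Γ` is an open symmetric convex cone with vertex at the origin and nonempty boundary, and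
`Γₙ ⊆ Γ ⊆ Γ₁`. -/
structure IsSymmetricCone {n : ℕ} (Γ : Set (Fin n → ℝ)) : Prop where
  isOpen : IsOpen Γ
  convex : Convex ℝ Γ
  cone : ∀ l ∈ Γ, ∀ t : ℝ, 0 < t → t • l ∈ Γ
  symmetric : ∀ l ∈ Γ, ∀ s : Equiv.Perm (Fin n), l ∘ s ∈ Γ
  frontier_nonempty : (frontier Γ).Nonempty
  positive_subset : ∀ l : Fin n → ℝ, (∀ i, 0 < l i) → l ∈ Γ
  subset_trace : ∀ l ∈ Γ, 0 < ∑ i, l i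

/-- `f` is smooth and symmetric on `Γ`, with `∂f/∂λᵢ > 0`, and concave. -/
structure IsStructureFunction {n : ℕ} (Γ : Set (Fin n → ℝ)) (f : (Fin n → ℝ) → ℝ) : Prop where
  smooth : ContDiffOn ℝ ∞ f Γ
  symmetric : ∀ l ∈ Γ, ∀ s : Equiv.Perm (Fin n), f (l ∘ s) = f l
  elliptic : ∀ l ∈ Γ, ∀ i, 0 < fderiv ℝ f l (Pi.single i 1)
  concave : ConcaveOn ℝ Γ f

/-- `sup_{∂Γ} f`, the supremum over `λ₀ ∈ ∂Γ` of `limsup_{λ → λ₀} f(λ)`; it may be infinite. -/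
def supFrontier {n : ℕ} (Γ : Set (Fin n → ℝ)) (f : (Fin n → ℝ) → ℝ) : EReal :=
  ⨆ l₀ ∈ frontier Γ, limsup (fun l => (f l : EReal)) (𝓝[Γ] l₀)

/-- `δ_{ψ,f} = inf_{M̄} ψ - sup_{∂Γ} f`. -/
def delta {n : ℕ} {M : Type*} (Γ : Set (Fin n → ℝ)) (f : (Fin n → ℝ) → ℝ) (ψ : M → ℝ) : EReal :=
  (⨅ p, (ψ p : EReal)) - supFrontier Γ f

end LeviFlatDirichlet

end

namespace LeviFlatDirichlet

/-! At `p₀` the vectors `ξ_α` together with `√2 ν`, read as vectors of type `(1,0)`, form a unitary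
frame. Let `A` and `B` be the matrices of `𝔤[u]` and `𝔤[v]` in this frame, `v` being the
subsolution. The estimate compares `A` with `B`.

Geometry: `u - v` vanishes on the boundary, so on real tangent vectors its Hessian is a multiple of
the Hessian of a defining function, the factor being a normal derivative of `u - v`
(`hessian_of_vanishing`). Summing over the directions `a` and `i a` produces the Levi form, which is
zero, so the unknown normal derivative drops out. Hence `A` and `B` agree in the upper left block
(`sesq_deform_eq`), and no gradient bound is needed.

Algebra (`IsStructureFunction.lt_of_large`): suppose `A_nn ≥ R + ∑ |A_αn|² / ε`. Testing `A` on its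
own orthonormal eigenvectors gives `λ(A) ≥ μ + d - ε (1, …, 1)` entrywise. Here `μ` is an average of
reorderings of `λ(B)` (Schur and Birkhoff), and `d`, formed from the squared last components of the
eigenvectors, is a probability vector. By symmetry and concavity `f(μ) ≥ f(λ(B))`. By strict
monotonicity and compactness, `f(μ + d - ε (1, …, 1)) > f(μ)` for one `ε` depending only on `Γ`, `f`
and `K`. So `λ(A) ∈ Γ` and `f(λ(A)) > f(λ(B))`.

Conclusion: the equation and the subsolution inequality pass from interior points to `p₀`
(`exists_tendsto_inner`), giving `f(λ(A)) = ψ(p₀) ≤ f(λ(B))`, which contradicts a large `A_nn`. That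
`λ(A)` lies in the open cone, where `f` is continuous, is itself supplied by the comparison. -/

/-! ### Second-order behaviour at the boundary -/

/-- A function with vanishing value and derivative and positive second derivative at the left end of
an interval is positive shortly after. -/
theorem eventually_pos_of_second_deriv_pos {φ ψ : ℝ → ℝ} {c δ : ℝ} (hδ : 0 < δ)
    (hφ : ∀ t ∈ Icc 0 δ, HasDerivWithinAt φ (ψ t) (Icc 0 δ) t) (hφ0 : φ 0 = 0) (hψ0 : ψ 0 = 0)
    (hψ : HasDerivWithinAt ψ c (Icc 0 δ) 0) (hc : 0 < c) : ∀ᶠ t in 𝓝[>] (0 : ℝ), 0 < φ t := by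
  have h1 : Tendsto (slope ψ 0) (𝓝[>] 0) (𝓝 c) := by
    have h := hasDerivWithinAt_iff_tendsto_slope.1 hψ
    have e : 𝓝[>] (0 : ℝ) ≤ 𝓝[Icc 0 δ \ {0}] 0 := by
      rw [Icc_sdiff_left, nhdsWithin_Ioc_eq_nhdsGT hδ]
    exact h.mono_left e
  have h2 : ∀ᶠ t in 𝓝[>] (0 : ℝ), 0 < ψ t := by
    filter_upwards [h1.eventually (lt_mem_nhds hc), self_mem_nhdsWithin] with t ht ht0
    have ht0' : (0 : ℝ) < t := ht0
    rw [slope_def_field, hψ0, sub_zero, sub_zero] at ht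
    exact (div_pos_iff_of_pos_right ht0').1 ht
  obtain ⟨η, hη, hsub⟩ := mem_nhdsGT_iff_exists_Ioo_subset.1 h2
  have hη' : (0 : ℝ) < η := hη
  have h3 : ∀ᶠ t in 𝓝[>] (0 : ℝ), t ∈ Ioo (0 : ℝ) (min η δ) :=
    Ioo_mem_nhdsGT (lt_min hη' hδ)
  filter_upwards [h3] with t ht
  have htη := ht.2.trans_le (min_le_left _ _)
  have htδ := ht.2.trans_le (min_le_right _ _)
  have hmono : StrictMonoOn φ (Icc 0 t) := by
    refine strictMonoOn_of_deriv_pos (convex_Icc 0 t) ?_ ?_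
    · intro s hs
      have hs' : s ∈ Icc 0 δ := ⟨hs.1, hs.2.trans htδ.le⟩
      exact (hφ s hs').continuousWithinAt.mono (Icc_subset_Icc_right htδ.le)
    · intro s hs
      rw [interior_Icc] at hs
      have hs' : s ∈ Icc 0 δ := ⟨hs.1.le, hs.2.le.trans htδ.le⟩
      have hd := (hφ s hs').hasDerivAt (Icc_mem_nhds hs.1 (hs.2.trans htδ))
      rw [hd.deriv]
      exact hsub ⟨hs.1, hs.2.trans htη⟩
  have := hmono (left_mem_Icc.2 ht.1.le) (right_mem_Icc.2 ht.1.le) ht.1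
  rwa [hφ0] at this

/-- The second derivative at the left end of an interval of a function bounded by `B t²`. -/
theorem abs_second_deriv_le {φ ψ : ℝ → ℝ} {c δ B : ℝ} (hδ : 0 < δ)
    (hφ : ∀ t ∈ Icc 0 δ, HasDerivWithinAt φ (ψ t) (Icc 0 δ) t) (hφ0 : φ 0 = 0) (hψ0 : ψ 0 = 0)
    (hψ : HasDerivWithinAt ψ c (Icc 0 δ) 0) (hB : ∀ᶠ t in 𝓝[>] (0 : ℝ), |φ t| ≤ B * t ^ 2) :
    |c| ≤ 2 * B := by
  have hsq : ∀ t : ℝ, HasDerivWithinAt (fun s : ℝ => B * s ^ 2) (B * (2 * t)) (Icc 0 δ) t := by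
    intro t
    have := ((hasDerivAt_pow 2 t).const_mul B).hasDerivWithinAt (s := Icc 0 δ)
    simpa using this
  have hlin : HasDerivWithinAt (fun s : ℝ => B * (2 * s)) (2 * B) (Icc 0 δ) 0 := by
    have := (((hasDerivAt_id (0 : ℝ)).const_mul 2).const_mul B).hasDerivWithinAt (s := Icc 0 δ)
    simpa [mul_comm] using this
  rw [abs_le]
  constructor
  · by_contra! hlt
    have h := eventually_pos_of_second_deriv_pos (φ := fun t => -φ t - B * t ^ 2)
      (ψ := fun t => -ψ t - B * (2 * t)) (c := -c - 2 * B) hδ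
      (fun t ht => (hφ t ht).fun_neg.fun_sub (hsq t)) (by simp [hφ0]) (by simp [hψ0])
      (hψ.fun_neg.fun_sub hlin) (by linarith)
    obtain ⟨t, h1, h2⟩ := (h.and hB).exists
    have := neg_abs_le (φ t)
    linarith
  · by_contra! hlt
    have h := eventually_pos_of_second_deriv_pos (φ := fun t => φ t - B * t ^ 2)
      (ψ := fun t => ψ t - B * (2 * t)) (c := c - 2 * B) hδ
      (fun t ht => (hφ t ht).fun_sub (hsq t)) (by simp [hφ0]) (by simp [hψ0])
      (hψ.fun_sub hlin) (by linarith)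
    obtain ⟨t, h1, h2⟩ := (h.and hB).exists
    have := le_abs_self (φ t)
    linarith

variable {E : Type*} [NormedAddCommGroup E] [NormedSpace ℝ E]

/-- The parabola through `z` with velocity `a` and acceleration `2 k N`. -/
def parabola (z a N : E) (k t : ℝ) : E := z + t • a + (k * t ^ 2) • N

@[simp] theorem parabola_zero (z a N : E) (k : ℝ) : parabola z a N k 0 = z := by
  simp [parabola]

theorem hasDerivAt_parabola (z a N : E) (k t : ℝ) :
    HasDerivAt (parabola z a N k) (a + (2 * k * t) • N) t := by
  have h1 : HasDerivAt (fun s : ℝ => s • a) a t := by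
    simpa using (hasDerivAt_id t).smul_const a
  have h2 : HasDerivAt (fun s : ℝ => (k * s ^ 2) • N) ((2 * k * t) • N) t := by
    have := ((hasDerivAt_pow 2 t).const_mul k).smul_const N
    convert this using 2
    simp; ring
  exact (h1.const_add z).fun_add h2

theorem hasDerivAt_parabola_coeff (z a N : E) (k t : ℝ) :
    HasDerivAt (fun s => parabola z a N s t) (t ^ 2 • N) k := by
  have h2 : HasDerivAt (fun s : ℝ => (s * t ^ 2) • N) (t ^ 2 • N) k := by
    simpa using ((hasDerivAt_id k).mul_const (t ^ 2)).smul_const N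
  exact h2.const_add (z + t • a)

theorem continuous_parabola (z a N : E) : Continuous fun q : ℝ × ℝ => parabola z a N q.1 q.2 := by
  unfold parabola; fun_prop

theorem hasDerivWithinAt_comp_parabola {T : Set E} {h : E → ℝ} {h' : E → E →L[ℝ] ℝ}
    {z a N : E} {k δ : ℝ} (hh : ∀ w ∈ T, HasFDerivWithinAt h (h' w) T w)
    (hmaps : MapsTo (parabola z a N k) (Icc 0 δ) T) :
    ∀ t ∈ Icc 0 δ, HasDerivWithinAt (fun t => h (parabola z a N k t))
      (h' (parabola z a N k t) (a + (2 * k * t) • N)) (Icc 0 δ) t := fun t ht =>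
  (hh _ (hmaps ht)).comp_hasDerivWithinAt t (hasDerivAt_parabola z a N k t).hasDerivWithinAt hmaps

/-- Differentiating `h'` along the curve contributes `h'' a a`; the acceleration `2 k N` contributes
the first-order term. The parameter `k` is what couples the Hessian to the normal derivative. -/
theorem hasDerivWithinAt_deriv_comp_parabola {T : Set E} {h' : E → E →L[ℝ] ℝ}
    {h'' : E →L[ℝ] E →L[ℝ] ℝ} {z a N : E} {k δ : ℝ}
    (hh : HasFDerivWithinAt h' h'' T z) (hmaps : MapsTo (parabola z a N k) (Icc 0 δ) T) :
    HasDerivWithinAt (fun t => h' (parabola z a N k t) (a + (2 * k * t) • N))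
      (h'' a a + 2 * k * h' z N) (Icc 0 δ) 0 := by
  have h1 : HasDerivWithinAt (fun t => h' (parabola z a N k t)) (h'' a) (Icc 0 δ) 0 := by
    have hd : HasDerivWithinAt (parabola z a N k) a (Icc 0 δ) 0 := by
      simpa using (hasDerivAt_parabola z a N k 0).hasDerivWithinAt
    have hh' : HasFDerivWithinAt h' h'' T (parabola z a N k 0) := by simpa using hh
    exact hh'.comp_hasDerivWithinAt 0 hd hmaps
  have h2 : HasDerivWithinAt (fun t : ℝ => a + (2 * k * t) • N) ((2 * k) • N) (Icc 0 δ) 0 := by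
    have := (((hasDerivAt_id (0 : ℝ)).const_mul (2 * k)).smul_const N).const_add a
    simpa using this.hasDerivWithinAt (s := Icc 0 δ)
  have := h1.clm_apply h2
  simpa using this

/-- If `h` is `C²` up to the boundary of `S = {ρ ≤ 0}` and vanishes on the boundary, then on tangent
vectors its Hessian is a multiple of that of `ρ`. -/
theorem hessian_of_vanishing {S V : Set E} {z : E} {ρ h : E → ℝ} {ρ' h' : E → E →L[ℝ] ℝ}
    {ρ'' h'' : E →L[ℝ] E →L[ℝ] ℝ} (hV : IsOpen V) (hz : z ∈ V) (hSV : S ∩ V = {w ∈ V | ρ w ≤ 0})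
    (hρ : ∀ w ∈ V, HasFDerivAt ρ (ρ' w) w) (hρ'' : HasFDerivAt ρ' ρ'' z)
    (hh : ∀ w ∈ S ∩ V, HasFDerivWithinAt h (h' w) (S ∩ V) w)
    (hh'' : HasFDerivWithinAt h' h'' (S ∩ V) z) (hz0 : ρ z = 0)
    (hvan : ∀ w ∈ V, ρ w = 0 → h w = 0) {a N : E} (ha : ρ' z a = 0) (hN : ρ' z N = -1) :
    h'' a a + ρ'' a a * h' z N = 0 := by
  have hzS : z ∈ S ∩ V := by rw [hSV]; exact ⟨hz, hz0.le⟩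
  obtain ⟨r, hr, hball⟩ : ∃ r > 0, ∀ w ∈ Metric.ball z r, w ∈ V ∧ ρ' w N < 0 ∧
      (w ∈ S ∩ V → ‖h' w‖ < ‖h' z‖ + 1) := by
    have e1 : ∀ᶠ w in 𝓝 z, w ∈ V := hV.mem_nhds hz
    have e2 : ∀ᶠ w in 𝓝 z, ρ' w N < 0 := by
      have : ContinuousAt (fun w => ρ' w N) z := hρ''.continuousAt.clm_apply continuousAt_const
      exact this.eventually (gt_mem_nhds (by simp [hN]))
    have e3 : ∀ᶠ w in 𝓝 z, w ∈ S ∩ V → ‖h' w‖ < ‖h' z‖ + 1 := by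
      have := hh''.continuousWithinAt.norm.eventually (gt_mem_nhds (lt_add_one ‖h' z‖))
      exact eventually_nhdsWithin_iff.1 this
    obtain ⟨r, hr, hb⟩ := Metric.eventually_nhds_iff_ball.1 (e1.and (e2.and e3))
    exact ⟨r, hr, hb⟩
  set L := ‖h' z‖ + 1 with hL
  set κ := ρ'' a a / 2 with hκ
  -- Along the parabola with coefficient `k` the second derivative of `ρ` at `0` is `ρ'' a a - 2 k`,
  -- which vanishes at `k = κ`. So the coefficients `κ - ε` and `κ + ε` give curves just outside and
  -- just inside `S`, enclosing the boundary within distance `O(ε t²)`; no parametrization of the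
  -- boundary is required.
  have key : ∀ ε > 0, |h'' a a + 2 * (κ + ε) * h' z N| ≤ 2 * (L * ‖N‖ * (2 * ε)) := by
    intro ε hε
    -- all parabolas with coefficients near `κ` stay in the ball for a short time
    obtain ⟨δ, hδ, hin⟩ : ∃ δ > 0, ∀ t ∈ Icc 0 δ, ∀ k ∈ Icc (κ - ε) (κ + ε),
        parabola z a N k t ∈ Metric.ball z r := by
      have hopen : IsOpen {q : ℝ × ℝ | parabola z a N q.1 q.2 ∈ Metric.ball z r} :=
        Metric.isOpen_ball.preimage (continuous_parabola z a N)
      obtain ⟨u, v, hu, hv, hku, h0v, huv⟩ := generalized_tube_lemma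
        (isCompact_Icc (a := κ - ε) (b := κ + ε)) (isCompact_singleton (x := (0 : ℝ))) hopen
        (by rintro ⟨k, t⟩ ⟨-, ht⟩
            have : t = 0 := ht
            simp [this, hr])
      obtain ⟨δ, hδ, hb⟩ := Metric.isOpen_iff.1 hv 0 (h0v rfl)
      refine ⟨δ / 2, half_pos hδ, fun t ht k hk => huv (mk_mem_prod (hku hk) (hb ?_))⟩
      rw [Metric.mem_ball, Real.dist_eq, sub_zero, abs_of_nonneg ht.1]
      linarith [ht.2]
    have hmapsV : ∀ k ∈ Icc (κ - ε) (κ + ε), MapsTo (parabola z a N k) (Icc 0 δ) V :=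
      fun k hk t ht => (hball _ (hin t ht k hk)).1
    have hm : κ - ε ∈ Icc (κ - ε) (κ + ε) := ⟨le_rfl, by linarith⟩
    have hp : κ + ε ∈ Icc (κ - ε) (κ + ε) := ⟨by linarith, le_rfl⟩
    have hpos : ∀ᶠ t in 𝓝[>] (0 : ℝ), 0 < ρ (parabola z a N (κ - ε) t) := by
      refine eventually_pos_of_second_deriv_pos hδ
        (hasDerivWithinAt_comp_parabola (fun w hw => (hρ w hw).hasFDerivWithinAt) (hmapsV _ hm))
        (by simpa using hz0) (by simpa using ha)
        (hasDerivWithinAt_deriv_comp_parabola hρ''.hasFDerivWithinAt (hmapsV _ hm)) ?_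
      rw [hN, hκ]; linarith
    have hneg : ∀ᶠ t in 𝓝[>] (0 : ℝ), 0 < -ρ (parabola z a N (κ + ε) t) := by
      refine eventually_pos_of_second_deriv_pos hδ
        (fun t ht => (hasDerivWithinAt_comp_parabola
          (fun w hw => (hρ w hw).hasFDerivWithinAt) (hmapsV _ hp) t ht).fun_neg)
        (by simpa using hz0) (by simpa using ha)
        (hasDerivWithinAt_deriv_comp_parabola hρ''.hasFDerivWithinAt (hmapsV _ hp)).fun_neg ?_
      rw [hN, hκ]; linarith
    have hbound : ∀ᶠ t in 𝓝[>] (0 : ℝ),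
        |h (parabola z a N (κ + ε) t)| ≤ L * ‖N‖ * (2 * ε) * t ^ 2 := by
      filter_upwards [hpos, hneg, Ioo_mem_nhdsGT hδ] with t h1 h2 ht
      have ht' : t ∈ Icc 0 δ := ⟨ht.1.le, ht.2.le⟩
      have hder : ∀ k ∈ Icc (κ - ε) (κ + ε), HasDerivAt (fun s => ρ (parabola z a N s t))
          (ρ' (parabola z a N k t) (t ^ 2 • N)) k := fun k hk =>
        (hρ _ (hmapsV k hk ht')).comp_hasDerivAt k (hasDerivAt_parabola_coeff z a N k t)
      have hcont : ContinuousOn (fun s => ρ (parabola z a N s t)) (Icc (κ - ε) (κ + ε)) :=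
        fun k hk => (hder k hk).continuousAt.continuousWithinAt
      -- At fixed `t`, moving in the direction `N` from the outer to the inner curve meets the
      -- boundary, where `h` vanishes; the mean value inequality then bounds `h` on the inner curve.
      obtain ⟨σ, hσ, hσ0⟩ : ∃ σ ∈ Icc (κ - ε) (κ + ε), ρ (parabola z a N σ t) = 0 :=
        intermediate_value_Icc' (by linarith) hcont ⟨by linarith, h1.le⟩
      have hanti : AntitoneOn (fun s => ρ (parabola z a N s t)) (Icc (κ - ε) (κ + ε)) := by
        refine antitoneOn_of_deriv_nonpos (convex_Icc _ _) hcont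
          (fun k hk => (hder k (interior_subset hk)).differentiableAt.differentiableWithinAt) ?_
        intro k hk
        have hk' := interior_subset hk
        rw [(hder k hk').deriv, map_smul, smul_eq_mul]
        exact mul_nonpos_of_nonneg_of_nonpos (sq_nonneg t) (hball _ (hin t ht' k hk')).2.1.le
      have hsub : Icc σ (κ + ε) ⊆ Icc (κ - ε) (κ + ε) := Icc_subset_Icc_left hσ.1
      -- Since `h` is differentiable only within `S`, the segment used in the mean value inequality
      -- must not leave `S`; this follows from the monotonicity of `ρ` in `k`.
      have hS : ∀ k ∈ Icc σ (κ + ε), parabola z a N k t ∈ S ∩ V := by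
        intro k hk
        rw [hSV]
        refine ⟨hmapsV k (hsub hk) ht', ?_⟩
        have := hanti hσ (hsub hk) hk.1
        simp only [hσ0] at this
        exact this
      have hmv := norm_image_sub_le_of_norm_deriv_le_segment' (a := σ) (b := κ + ε)
        (f := fun s => h (parabola z a N s t))
        (f' := fun k => h' (parabola z a N k t) (t ^ 2 • N)) (C := L * (t ^ 2 * ‖N‖))
        (fun k hk => (hh _ (hS k hk)).comp_hasDerivWithinAt k
          (hasDerivAt_parabola_coeff z a N k t).hasDerivWithinAt hS)
        (fun k hk => by
          have hk' : k ∈ Icc σ (κ + ε) := Ico_subset_Icc_self hk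
          refine (ContinuousLinearMap.le_opNorm _ _).trans ?_
          rw [norm_smul, Real.norm_of_nonneg (sq_nonneg t)]
          exact mul_le_mul_of_nonneg_right ((hball _ (hin t ht' k (hsub hk'))).2.2 (hS k hk')).le
            (by positivity)) (κ + ε) (right_mem_Icc.2 hσ.2)
      simp only [hvan _ (hmapsV σ hσ ht') hσ0, sub_zero, Real.norm_eq_abs] at hmv
      refine hmv.trans ?_
      have : κ + ε - σ ≤ 2 * ε := by linarith [hσ.1]
      calc L * (t ^ 2 * ‖N‖) * (κ + ε - σ) ≤ L * (t ^ 2 * ‖N‖) * (2 * ε) := by gcongr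
        _ = _ := by ring
    -- restrict to a shorter time on which the parabola stays in `S`
    obtain ⟨η, hη, hη'⟩ := mem_nhdsGT_iff_exists_Ioc_subset.1 hneg
    have hη0 : (0 : ℝ) < η := hη
    have hmapsS : MapsTo (parabola z a N (κ + ε)) (Icc 0 (min η δ)) (S ∩ V) := by
      intro t ht
      rcases ht.1.eq_or_lt with h0 | h0
      · rw [← h0]; simpa using hzS
      · rw [hSV]
        refine ⟨hmapsV _ hp ⟨ht.1, ht.2.trans (min_le_right _ _)⟩, ?_⟩
        have : 0 < -ρ (parabola z a N (κ + ε) t) := hη' ⟨h0, ht.2.trans (min_le_left _ _)⟩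
        linarith
    have hd := hasDerivWithinAt_comp_parabola hh hmapsS
    have hmin : 0 < min η δ := lt_min hη0 hδ
    have hφ0 : h (parabola z a N (κ + ε) 0) = 0 := by simpa using hvan z hz hz0
    -- The tangential derivative of `h` vanishes because `h` is `O(t²)` along a curve with velocity
    -- `a`.
    have hψ0 : h' (parabola z a N (κ + ε) 0) (a + (2 * (κ + ε) * 0) • N) = 0 := by
      have h1 := hasDerivWithinAt_iff_tendsto_slope.1 (hd 0 (left_mem_Icc.2 hmin.le))
      rw [Icc_sdiff_left, nhdsWithin_Ioc_eq_nhdsGT hmin] at h1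
      refine tendsto_nhds_unique h1 (squeeze_zero_norm' (a := fun t => L * ‖N‖ * (2 * ε) * t) ?_ ?_)
      · filter_upwards [hbound, self_mem_nhdsWithin] with t h2 ht
        have ht' : (0 : ℝ) < t := ht
        rw [slope_def_field, hφ0, sub_zero, sub_zero, norm_div, Real.norm_eq_abs,
          Real.norm_of_nonneg ht'.le, div_le_iff₀ ht']
        calc _ ≤ _ := h2
          _ = _ := by ring
      · have : Tendsto (fun t : ℝ => L * ‖N‖ * (2 * ε) * t) (𝓝 0) (𝓝 (L * ‖N‖ * (2 * ε) * 0)) :=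
          tendsto_id.const_mul _
        rw [mul_zero] at this
        exact this.mono_left nhdsWithin_le_nhds
    exact abs_second_deriv_le hmin hd hφ0 hψ0
      (hasDerivWithinAt_deriv_comp_parabola hh'' hmapsS) hbound
  have hlim1 : Tendsto (fun ε : ℝ => |h'' a a + 2 * (κ + ε) * h' z N|) (𝓝[>] 0)
      (𝓝 |h'' a a + 2 * (κ + 0) * h' z N|) := by
    refine Tendsto.mono_left (Continuous.tendsto ?_ 0) nhdsWithin_le_nhds
    fun_prop
  have hlim2 : Tendsto (fun ε : ℝ => 2 * (L * ‖N‖ * (2 * ε))) (𝓝[>] 0)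
      (𝓝 (2 * (L * ‖N‖ * (2 * 0)))) := by
    refine Tendsto.mono_left (Continuous.tendsto ?_ 0) nhdsWithin_le_nhds
    fun_prop
  have hle := le_of_tendsto_of_tendsto hlim1 hlim2
    (by filter_upwards [self_mem_nhdsWithin] with ε hε using key ε hε)
  have h0 : |h'' a a + 2 * (κ + 0) * h' z N| = 0 :=
    le_antisymm (by simpa using hle) (abs_nonneg _)
  have := abs_eq_zero.1 h0
  rw [hκ] at this
  linarith

/-! ### Defining functions -/

namespace IsLocalDefiningFunction

variable {n : ℕ} {S : Set (CSpace n)} {z : CSpace n} {ρ ρ₁ ρ₂ : CSpace n → ℝ}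

theorem contDiffAt (h : IsLocalDefiningFunction S z ρ) : ContDiffAt ℝ 2 ρ z := by
  obtain ⟨V, hV, hz, hρ, -, -⟩ := h
  exact hρ.contDiffAt (hV.mem_nhds hz)

theorem hasFDerivAt (h : IsLocalDefiningFunction S z ρ) : HasFDerivAt ρ (fderiv ℝ ρ z) z :=
  (h.contDiffAt.differentiableAt two_ne_zero).hasFDerivAt

theorem fderiv_ne_zero (h : IsLocalDefiningFunction S z ρ) (h0 : ρ z = 0) : fderiv ℝ ρ z ≠ 0 := by
  obtain ⟨V, -, hz, -, -, hd⟩ := h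
  exact hd z hz h0

theorem exists_neg (h : IsLocalDefiningFunction S z ρ) (h0 : ρ z = 0) :
    ∃ N, fderiv ℝ ρ z N = -1 := by
  obtain ⟨w, hw⟩ : ∃ w, fderiv ℝ ρ z w ≠ 0 := by
    by_contra! hc
    exact h.fderiv_ne_zero h0 (ContinuousLinearMap.ext hc)
  refine ⟨(-(fderiv ℝ ρ z w)⁻¹) • w, ?_⟩
  rw [map_smul, smul_eq_mul, neg_mul, inv_mul_cancel₀ hw]

theorem nonpos_of_mem (h : IsLocalDefiningFunction S z ρ) (hz : z ∈ S) : ρ z ≤ 0 := by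
  obtain ⟨V, -, hzV, -, hS, -⟩ := h
  have : z ∈ {w ∈ V | ρ w ≤ 0} := hS ▸ ⟨hz, hzV⟩
  exact this.2

theorem mem_interior_of_neg (h : IsLocalDefiningFunction S z ρ) (hz : ρ z < 0) :
    z ∈ interior S := by
  obtain ⟨V, hV, hzV, hc, hS, -⟩ := h
  have h1 : ∀ᶠ w in 𝓝 z, ρ w < 0 :=
    (hc.contDiffAt (hV.mem_nhds hzV)).continuousAt.eventually (gt_mem_nhds hz)
  rw [mem_interior_iff_mem_nhds]
  filter_upwards [h1, hV.mem_nhds hzV] with w hw hwV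
  have : w ∈ S ∩ V := hS ▸ ⟨hwV, hw.le⟩
  exact this.1

/-- Being a defining function is an open condition on the base point. -/
theorem exists_isOpen (h : IsLocalDefiningFunction S z ρ) :
    ∃ V : Set (CSpace n), IsOpen V ∧ z ∈ V ∧ ContDiffOn ℝ 2 ρ V ∧ S ∩ V = {w ∈ V | ρ w ≤ 0} ∧
      ∀ w ∈ V, IsLocalDefiningFunction S w ρ := by
  obtain ⟨V, hV, hz, hc, hS, hd⟩ := h
  exact ⟨V, hV, hz, hc, hS, fun w hw => ⟨V, hV, hw, hc, hS, hd⟩⟩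

theorem eventually_neg (h : IsLocalDefiningFunction S z ρ) (h0 : ρ z = 0) {v : CSpace n}
    (hv : fderiv ℝ ρ z v < 0) : ∀ᶠ t in 𝓝[>] (0 : ℝ), ρ (z + t • v) < 0 := by
  have hline : HasDerivAt (fun t : ℝ => z + t • v) v 0 := by
    simpa using ((hasDerivAt_id (0 : ℝ)).smul_const v).const_add z
  have hρ : HasFDerivAt ρ (fderiv ℝ ρ z) (z + (0 : ℝ) • v) := by simpa using h.hasFDerivAt
  have hd := (hρ.comp_hasDerivAt 0 hline).hasDerivWithinAt (s := Ioi 0)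
  have h1 := hasDerivWithinAt_iff_tendsto_slope.1 hd
  rw [Set.sdiff_singleton_eq_self (by simp)] at h1
  filter_upwards [h1.eventually (gt_mem_nhds hv), self_mem_nhdsWithin] with t ht ht0
  have ht0' : (0 : ℝ) < t := ht0
  simp only [slope_def_field, Function.comp_apply, zero_smul, add_zero, h0, sub_zero] at ht
  exact not_le.1 fun hle => ht.not_ge (div_nonneg hle ht0'.le)

theorem tendsto_line (z v : CSpace n) :
    Tendsto (fun t : ℝ => z + t • v) (𝓝[>] (0 : ℝ)) (𝓝 z) := by
  have : Continuous fun t : ℝ => z + t • v := by fun_prop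
  exact (this.tendsto' 0 z (by simp)).mono_left nhdsWithin_le_nhds

/-- Inward segments stay in the interior. -/
theorem eventually_mem_interior (h : IsLocalDefiningFunction S z ρ) (h0 : ρ z = 0) {v : CSpace n}
    (hv : fderiv ℝ ρ z v < 0) : ∀ᶠ t in 𝓝[>] (0 : ℝ), z + t • v ∈ interior S := by
  obtain ⟨V, hV, hz, -, -, hVd⟩ := h.exists_isOpen
  filter_upwards [h.eventually_neg h0 hv, (tendsto_line z v).eventually (hV.mem_nhds hz)]
    with t ht htV
  exact (hVd _ htV).mem_interior_of_neg ht

/-- Moving along `-N` makes `ρ` positive at once, which leaves `S`. The lemma on inward segments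
applies to `-ρ`, a defining function of the opposite side. -/
theorem notMem_interior (h : IsLocalDefiningFunction S z ρ) (h0 : ρ z = 0) : z ∉ interior S := by
  intro hzi
  obtain ⟨N, hN⟩ := h.exists_neg h0
  obtain ⟨V, hV, hz, hc, hS, hd⟩ := h
  have hneg : IsLocalDefiningFunction {w | -ρ w ≤ 0} z (-ρ) := by
    refine ⟨V, hV, hz, hc.neg, ?_, fun w hw hw0 => ?_⟩
    · ext w; simp [and_comm]
    · have hd' := hd w hw (by simpa using hw0)
      rwa [fderiv_neg, neg_ne_zero]
  have h1 := hneg.eventually_neg (v := -N) (by simpa using h0) (by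
    rw [fderiv_neg]; simp [hN])
  have h2 := (tendsto_line z (-N)).eventually
    ((isOpen_interior.inter hV).mem_nhds ⟨hzi, hz⟩)
  obtain ⟨t, ht1, ht2⟩ := (h1.and h2).exists
  have : z + t • -N ∈ {w ∈ V | ρ w ≤ 0} := hS ▸ ⟨interior_subset ht2.1, ht2.2⟩
  have h3 := this.2
  simp only [Pi.neg_apply] at ht1
  linarith

theorem eq_zero_of_notMem_interior (h : IsLocalDefiningFunction S z ρ) (hz : z ∈ S)
    (hzi : z ∉ interior S) : ρ z = 0 :=
  le_antisymm (h.nonpos_of_mem hz) (not_lt.1 fun hlt => hzi (h.mem_interior_of_neg hlt))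

theorem mem_closure_interior (h : IsLocalDefiningFunction S z ρ) (hz : z ∈ S) :
    z ∈ closure (interior S) := by
  by_cases hzi : z ∈ interior S
  · exact subset_closure hzi
  have h0 := h.eq_zero_of_notMem_interior hz hzi
  obtain ⟨N, hN⟩ := h.exists_neg h0
  exact mem_closure_of_tendsto (tendsto_line z N)
    (h.eventually_mem_interior h0 (by rw [hN]; norm_num))

/-- At a boundary point the tangent cone contains the open half space `dρ < 0`, which spans. This
makes derivatives within `S` well defined up to the boundary. -/
theorem uniqueDiffWithinAt (h : IsLocalDefiningFunction S z ρ) (hz : z ∈ S) :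
    UniqueDiffWithinAt ℝ S z := by
  by_cases hzi : z ∈ interior S
  · exact uniqueDiffWithinAt_of_mem_nhds (mem_interior_iff_mem_nhds.1 hzi)
  have h0 := h.eq_zero_of_notMem_interior hz hzi
  obtain ⟨N, hN⟩ := h.exists_neg h0
  refine ⟨?_, subset_closure hz⟩
  have hsub : {v | fderiv ℝ ρ z v < 0} ⊆ tangentConeAt ℝ S z := by
    intro v hv
    refine mem_tangentConeAt_of_add_smul_mem (l := 𝓝[>] (0 : ℝ)) (c := id) ?_ ?_
    · exact nhdsWithin_mono 0 fun t (ht : 0 < t) => ht.ne'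
    · filter_upwards [h.eventually_mem_interior h0 hv] with t ht using interior_subset ht
  have hopen : IsOpen {v | fderiv ℝ ρ z v < 0} :=
    isOpen_lt (fderiv ℝ ρ z).continuous continuous_const
  have htop : Submodule.span ℝ (tangentConeAt ℝ S z) = ⊤ := by
    refine Submodule.eq_top_of_nonempty_interior' _ ⟨N, ?_⟩
    refine interior_mono (hsub.trans Submodule.subset_span) ?_
    rw [hopen.interior_eq]
    simp [hN]
  rw [htop]
  exact dense_univ

/-- The differentials of two defining functions at a boundary point are positive multiples of each
other. -/
theorem exists_fderiv_eq_smul (h₁ : IsLocalDefiningFunction S z ρ₁)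
    (h₂ : IsLocalDefiningFunction S z ρ₂) (h₁0 : ρ₁ z = 0) (h₂0 : ρ₂ z = 0) :
    ∃ c : ℝ, 0 < c ∧ ∀ v, fderiv ℝ ρ₂ z v = c * fderiv ℝ ρ₁ z v := by
  -- A direction pointing inward for `ρ₁` and outward for `ρ₂` would lead both into `S` and out of
  -- it.
  have hneg : ∀ v, fderiv ℝ ρ₁ z v < 0 → fderiv ℝ ρ₂ z v ≤ 0 := by
    intro v hv
    by_contra! hpos
    have h₂' : fderiv ℝ ρ₂ z (-v) < 0 := by simpa using hpos
    obtain ⟨V, hV, hz, hc, hS, hd⟩ := id h₂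
    have hneg : IsLocalDefiningFunction {w | -ρ₂ w ≤ 0} z (-ρ₂) := by
      refine ⟨V, hV, hz, hc.neg, ?_, fun w hw hw0 => ?_⟩
      · ext w; simp [and_comm]
      · have hd' := hd w hw (by simpa using hw0)
        rwa [fderiv_neg, neg_ne_zero]
    have e1 := hneg.eventually_neg (v := v) (by simpa using h₂0) (by rw [fderiv_neg]; simpa)
    have e2 := h₁.eventually_mem_interior h₁0 hv
    have e3 := (tendsto_line z v).eventually (hV.mem_nhds hz)
    obtain ⟨t, h1, h2, h3⟩ := (e1.and (e2.and e3)).exists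
    have : z + t • v ∈ {w ∈ V | ρ₂ w ≤ 0} := hS ▸ ⟨interior_subset h2, h3⟩
    have h4 := this.2
    simp only [Pi.neg_apply] at h1
    linarith
  obtain ⟨N, hN⟩ := h₁.exists_neg h₁0
  -- A tangent vector is a limit of the inward vectors `v + t N`; applying the result to `-v` as
  -- well shows that one kernel contains the other.
  have hker' : ∀ v, fderiv ℝ ρ₁ z v = 0 → fderiv ℝ ρ₂ z v ≤ 0 := by
    intro v hv
    have hlim : Tendsto (fun t : ℝ => fderiv ℝ ρ₂ z (v + t • N)) (𝓝[>] 0)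
        (𝓝 (fderiv ℝ ρ₂ z v)) :=
      ((fderiv ℝ ρ₂ z).continuous.tendsto v).comp (tendsto_line v N)
    refine le_of_tendsto hlim ?_
    filter_upwards [self_mem_nhdsWithin] with t ht
    have ht' : (0 : ℝ) < t := ht
    refine hneg _ ?_
    simp [hv, hN, ht']
  have hker : ∀ v, fderiv ℝ ρ₁ z v = 0 → fderiv ℝ ρ₂ z v = 0 := by
    intro v hv
    have h1 := hker' v hv
    have h2 := hker' (-v) (by simpa using hv)
    rw [map_neg] at h2
    linarith
  have hform : ∀ v, fderiv ℝ ρ₂ z v = -fderiv ℝ ρ₂ z N * fderiv ℝ ρ₁ z v := by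
    intro v
    have := hker (v + fderiv ℝ ρ₁ z v • N) (by simp [hN])
    rw [map_add, map_smul, smul_eq_mul] at this
    linarith
  refine ⟨-fderiv ℝ ρ₂ z N, ?_, hform⟩
  have h1 := hneg N (by rw [hN]; norm_num)
  refine lt_of_le_of_ne (by linarith) fun h0 => ?_
  refine h₂.fderiv_ne_zero h₂0 (ContinuousLinearMap.ext fun v => ?_)
  rw [hform v, ← h0]; simp

end IsLocalDefiningFunction

/-! ### The boundary in charts -/

namespace ComplexManifoldWithBoundary

variable {n : ℕ} {M : Type*} [TopologicalSpace M] (X : ComplexManifoldWithBoundary n M)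
  {e e' : PartialEquiv M (CSpace n)}

theorem uniqueDiffOn_target (he : e ∈ X.atlas) : UniqueDiffOn ℝ e.target := fun z hz => by
  obtain ⟨ρ, hρ⟩ := X.c2_boundary e he z hz
  exact hρ.uniqueDiffWithinAt hz

/-- Interior points of one chart are interior points of every other chart. -/
theorem mem_interior_target (he : e ∈ X.atlas) (he' : e' ∈ X.atlas) {p : M} (hp : p ∈ e.source)
    (hp' : p ∈ e'.source) (hint : e p ∈ interior e.target) : e' p ∈ interior e'.target := by
  set T := e' ∘ e.symm with hT
  set T' := e ∘ e'.symm with hT'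
  set D := (e.symm.trans e').source with hD
  set D' := (e'.symm.trans e).source with hD'
  have hpe : e.symm (e p) = p := e.left_inv hp
  have hpe' : e'.symm (e' p) = p := e'.left_inv hp'
  have hTz : T (e p) = e' p := by simp [hT, hpe]
  have hTz' : T' (e' p) = e p := by simp [hT', hpe']
  -- The transition out of `e` is defined on a full neighbourhood, but the reverse one may a priori
  -- live on a one-sided set `D'`, so only derivatives within `D'` are available for it.
  have hDn : D ∈ 𝓝 (e p) := by
    have h1 : e.target ∈ 𝓝 (e p) := mem_interior_iff_mem_nhds.1 hint
    have h2 : ContinuousAt e.symm (e p) := (X.continuousOn_symm e he).continuousAt h1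
    have h3 : e'.source ∈ 𝓝 (e.symm (e p)) := by
      rw [hpe]; exact (X.isOpen_source e' he').mem_nhds hp'
    filter_upwards [h1, h2.preimage_mem_nhds h3] with w hw1 hw2
    simpa [hD] using ⟨hw1, hw2⟩
  have hmaps : MapsTo T D D' := by
    intro w hw
    simp only [hD, PartialEquiv.trans_source, PartialEquiv.symm_source, mem_inter_iff,
      mem_preimage] at hw
    simp only [hD', hT, PartialEquiv.trans_source, PartialEquiv.symm_source, mem_inter_iff,
      mem_preimage, Function.comp_apply]
    refine ⟨e'.map_source hw.2, ?_⟩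
    rw [e'.left_inv hw.2]
    exact e.map_target hw.1
  have hinv : ∀ w ∈ D, T' (T w) = w := by
    intro w hw
    simp only [hD, PartialEquiv.trans_source, PartialEquiv.symm_source, mem_inter_iff,
      mem_preimage] at hw
    simp only [hT, hT', Function.comp_apply]
    rw [e'.left_inv hw.2, e.right_inv hw.1]
  have hcd : ContDiffAt ℂ ∞ T (e p) := (X.holomorphic e he e' he').contDiffAt hDn
  have hstrict : HasStrictFDerivAt T (fderiv ℂ T (e p)) (e p) :=
    hcd.hasStrictFDerivAt (by simp)
  have hzD' : e' p ∈ D' := by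
    have := hmaps (mem_of_mem_nhds hDn)
    rwa [hTz] at this
  have hd' : HasFDerivWithinAt T' (fderivWithin ℂ T' D' (e' p)) D' (T (e p)) := by
    rw [hTz]
    exact ((X.holomorphic e' he' e he).differentiableOn (by simp) _ hzD').hasFDerivWithinAt
  have hcomp := hd'.comp (e p) hstrict.hasFDerivAt.hasFDerivWithinAt hmaps
  have hid : HasFDerivAt (T' ∘ T) (ContinuousLinearMap.id ℂ (CSpace n)) (e p) :=
    (hasFDerivAt_id (e p)).congr_of_eventuallyEq (by
      filter_upwards [hDn] with w hw using hinv w hw)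
  have heq := (hcomp.hasFDerivAt hDn).unique hid
  have hinj : Function.Injective (fderiv ℂ T (e p)) := by
    intro a b hab
    have ha := DFunLike.congr_fun heq a
    have hb := DFunLike.congr_fun heq b
    simp only [ContinuousLinearMap.comp_apply, ContinuousLinearMap.id_apply] at ha hb
    rw [← ha, ← hb, hab]
  -- In equal finite dimensions an injective derivative is surjective, so `T` is open at `e p` and
  -- its image fills a neighbourhood of `e' p` inside `e'.target`.
  have hsurj : (fderiv ℂ T (e p)).range = ⊤ :=
    LinearMap.range_eq_top.2 (LinearMap.injective_iff_surjective.1 hinj)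
  have hmap := hstrict.map_nhds_eq_of_surj hsurj
  rw [hTz] at hmap
  rw [mem_interior_iff_mem_nhds, ← hmap, mem_map]
  filter_upwards [hDn] with w hw
  have := hmaps hw
  simp only [hD', PartialEquiv.trans_source, PartialEquiv.symm_source, mem_inter_iff] at this
  exact this.1

theorem mem_boundary_iff (he : e ∈ X.atlas) {p : M} (hp : p ∈ e.source) :
    p ∈ X.boundary ↔ e p ∉ interior e.target := by
  constructor
  · rintro ⟨e', he', hp', hb⟩ hint
    exact hb (X.mem_interior_target he he' hp hp' hint)
  · exact fun hb => ⟨e, he, hp, hb⟩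

theorem mem_inner_iff (he : e ∈ X.atlas) {p : M} (hp : p ∈ e.source) :
    p ∈ X.inner ↔ e p ∈ interior e.target := by
  rw [inner, mem_compl_iff, X.mem_boundary_iff he hp, not_not]

end ComplexManifoldWithBoundary

/-! ### Sesquilinear forms -/

section Sesq

variable {n : ℕ}

/-- The value `∑ Gᵢⱼ aᵢ b̄ⱼ` of a sesquilinear form. -/
noncomputable def sesq (G : Matrix (Fin n) (Fin n) ℂ) (a b : CSpace n) : ℂ :=
  ∑ i, ∑ j, G i j * (a i * star (b j))

theorem sesq_add_left (G : Matrix (Fin n) (Fin n) ℂ) (a a' b : CSpace n) :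
    sesq G (a + a') b = sesq G a b + sesq G a' b := by
  simp only [sesq, ← Finset.sum_add_distrib]
  exact Finset.sum_congr rfl fun i _ => Finset.sum_congr rfl fun j _ => by
    simp only [Pi.add_apply]; ring

theorem sesq_add_right (G : Matrix (Fin n) (Fin n) ℂ) (a b b' : CSpace n) :
    sesq G a (b + b') = sesq G a b + sesq G a b' := by
  simp only [sesq, ← Finset.sum_add_distrib]
  exact Finset.sum_congr rfl fun i _ => Finset.sum_congr rfl fun j _ => by
    simp only [Pi.add_apply, star_add]; ring

theorem sesq_smul_left (G : Matrix (Fin n) (Fin n) ℂ) (c : ℂ) (a b : CSpace n) :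
    sesq G (c • a) b = c * sesq G a b := by
  simp only [sesq, Finset.mul_sum]
  exact Finset.sum_congr rfl fun i _ => Finset.sum_congr rfl fun j _ => by
    simp only [Pi.smul_apply, smul_eq_mul]; ring

theorem sesq_smul_right (G : Matrix (Fin n) (Fin n) ℂ) (c : ℂ) (a b : CSpace n) :
    sesq G a (c • b) = star c * sesq G a b := by
  simp only [sesq, Finset.mul_sum]
  exact Finset.sum_congr rfl fun i _ => Finset.sum_congr rfl fun j _ => by
    simp only [Pi.smul_apply, smul_eq_mul, star_mul']; ring

theorem sesq_add_matrix (G H : Matrix (Fin n) (Fin n) ℂ) (a b : CSpace n) :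
    sesq (G + H) a b = sesq G a b + sesq H a b := by
  simp only [sesq, ← Finset.sum_add_distrib]
  exact Finset.sum_congr rfl fun i _ => Finset.sum_congr rfl fun j _ => by
    simp only [Matrix.add_apply]; ring

theorem star_sesq {G : Matrix (Fin n) (Fin n) ℂ} (hG : G.IsHermitian) (a b : CSpace n) :
    star (sesq G a b) = sesq G b a := by
  simp only [sesq, star_sum]
  rw [Finset.sum_comm]
  refine Finset.sum_congr rfl fun i _ => Finset.sum_congr rfl fun j _ => ?_
  rw [star_mul', star_mul', star_star, hG.apply]; ring

/-- Polarization. -/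
theorem sesq_eq_zero_of_diag {G : Matrix (Fin n) (Fin n) ℂ} {P : CSpace n → Prop}
    (hadd : ∀ a b, P a → P b → P (a + b)) (hsmul : ∀ a, P a → P (Complex.I • a))
    (hdiag : ∀ a, P a → sesq G a a = 0) {a b : CSpace n} (ha : P a) (hb : P b) :
    sesq G a b = 0 := by
  have h1 := hdiag _ (hadd a b ha hb)
  have h2 := hdiag _ (hadd a _ ha (hsmul b hb))
  simp only [sesq_add_left, sesq_add_right, sesq_smul_left, sesq_smul_right, hdiag a ha,
    hdiag b hb, Complex.star_def, Complex.conj_I] at h1 h2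
  have h3 : Complex.I * (sesq G b a - sesq G a b) = 0 := by linear_combination h2
  have h4 := (mul_eq_zero.1 h3).resolve_left Complex.I_ne_zero
  linear_combination (h1 - h4) / 2

/-- On vectors of type `(1,0)` the form is sesquilinear. -/
theorem form_conj (G : Matrix (Fin n) (Fin n) ℂ) (a b : CSpace n) :
    form G (a, 0) (J (conjVec (b, 0))) = sesq G a b := by
  simp only [form, J, conjVec, sesq, Finset.mul_sum]
  refine Finset.sum_congr rfl fun i _ => Finset.sum_congr rfl fun j _ => ?_
  simp only [Pi.smul_apply, Pi.star_apply, Pi.zero_apply, smul_eq_mul, mul_zero, sub_zero]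
  linear_combination (-(G i j * (a i * star (b j)))) * Complex.I_mul_I

/-- For Hermitian `G` the right side is twice the real part of the Hermitian product. A real unit
vector therefore has Hermitian square norm `1/2`, the source of the `√2` in the frame. -/
theorem form_ofReal (G : Matrix (Fin n) (Fin n) ℂ) (a b : CSpace n) :
    form G (ofReal a) (J (ofReal b)) = sesq G a b + sesq G b a := by
  simp only [form, J, ofReal, sesq, Finset.mul_sum, ← Finset.sum_add_distrib]
  refine Finset.sum_congr rfl fun i _ => Finset.sum_congr rfl fun j _ => ?_
  simp only [Pi.smul_apply, Pi.star_apply, smul_eq_mul]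
  linear_combination (-(G i j * (a i * star (b j)) + G i j * (b i * star (a j)))) *
    Complex.I_mul_I

theorem eq_of_J_eq {ξ : CTangent n} (h : J ξ = Complex.I • ξ) : ξ = (ξ.1, 0) := by
  have h2 := congrArg Prod.snd h
  refine Prod.ext rfl ?_
  funext i
  have := congrFun h2 i
  simp only [J, Prod.smul_snd, Pi.smul_apply, smul_eq_mul] at this
  have h3 : Complex.I * ξ.2 i = 0 := by linear_combination -this / 2
  exact (mul_eq_zero.1 h3).resolve_left Complex.I_ne_zero

/-- The vector `ξ_n` is the `(1,0)` part of the real normal. -/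
theorem half_ofReal_sub (ν : CSpace n) :
    (1 / 2 : ℂ) • (ofReal ν - Complex.I • J (ofReal ν)) = (ν, 0) := by
  refine Prod.ext ?_ ?_ <;> funext i <;>
    simp only [ofReal, J, Prod.smul_fst, Prod.fst_sub, Prod.smul_snd, Prod.snd_sub,
      Pi.smul_apply, Pi.sub_apply, Pi.star_apply, smul_eq_mul, Pi.zero_apply]
  · linear_combination (-(ν i) / 2) * Complex.I_mul_I
  · linear_combination (star (ν i) / 2) * Complex.I_mul_I

end Sesq

/-! ### Complex Hessians -/

section Hessian

variable {n : ℕ}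

theorem eq_sum_re_im (a : CSpace n) :
    a = ∑ i, ((a i).re • (Pi.single i 1 : CSpace n) + (a i).im • (Pi.single i Complex.I : CSpace n)) := by
  funext j
  rw [Finset.sum_apply]
  simp only [Pi.add_apply, Pi.smul_apply]
  rw [Finset.sum_eq_single j]
  · simp [Complex.re_add_im]
  · intro i _ hij
    simp [Pi.single_eq_of_ne' hij]
  · simp

theorem realLinear_apply (L : CSpace n →L[ℝ] ℝ) (a : CSpace n) :
    L a = ∑ i, ((a i).re * L (Pi.single i 1) + (a i).im * L (Pi.single i Complex.I)) := by
  conv_lhs => rw [eq_sum_re_im a]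
  simp [map_sum]

theorem dC_eq (ρ : CSpace n → ℝ) (z a : CSpace n) :
    dC ρ z (a, 0) = ((fderiv ℝ ρ z a : ℂ) - Complex.I * (fderiv ℝ ρ z (Complex.I • a) : ℂ)) / 2 := by
  rw [realLinear_apply (fderiv ℝ ρ z) a, realLinear_apply (fderiv ℝ ρ z) (Complex.I • a)]
  push_cast
  rw [Finset.mul_sum, ← Finset.sum_sub_distrib, Finset.sum_div]
  refine Finset.sum_congr rfl fun i _ => ?_
  simp only [Pi.zero_apply, mul_zero, add_zero, Pi.smul_apply, smul_eq_mul, Complex.mul_re,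
    Complex.mul_im, Complex.I_re, Complex.I_im, zero_mul, one_mul, zero_sub, zero_add,
    Complex.ofReal_neg]
  conv_lhs => rw [← Complex.re_add_im (a i)]
  linear_combination (-(fderiv ℝ ρ z (Pi.single i Complex.I) : ℂ) * (a i).im / 2) *
    Complex.I_mul_I

/-- The two conditions are the real and imaginary parts of one equation. They supply the two real
tangent directions `a` and `i a` to which the Hessian identity is applied. -/
theorem dC_eq_zero_iff (ρ : CSpace n → ℝ) (z a : CSpace n) :
    dC ρ z (a, 0) = 0 ↔ fderiv ℝ ρ z a = 0 ∧ fderiv ℝ ρ z (Complex.I • a) = 0 := by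
  rw [dC_eq]
  constructor
  · intro h
    have h' : (fderiv ℝ ρ z a : ℂ) - Complex.I * (fderiv ℝ ρ z (Complex.I • a) : ℂ) = 0 := by
      linear_combination 2 * h
    have hre := congrArg Complex.re h'
    have him := congrArg Complex.im h'
    simp at hre him
    exact ⟨hre, him⟩
  · rintro ⟨h1, h2⟩
    simp [h1, h2]

/-- The sesquilinear form of the complex Hessian of a function with real second derivative `D`. -/
theorem sesq_of_bilin (D : CSpace n →L[ℝ] CSpace n →L[ℝ] ℝ) {H : Matrix (Fin n) (Fin n) ℂ}
    (hH : ∀ i j, H i j =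
      (((D (Pi.single i 1) (Pi.single j 1)
          + D (Pi.single i Complex.I) (Pi.single j Complex.I) : ℝ) : ℂ)
        + Complex.I * ((D (Pi.single i 1) (Pi.single j Complex.I)
          - D (Pi.single i Complex.I) (Pi.single j 1) : ℝ) : ℂ)) / 4) (a b : CSpace n) :
    sesq H a b = (((D a b + D (Complex.I • a) (Complex.I • b) : ℝ) : ℂ)
      + Complex.I * ((D a (Complex.I • b) - D (Complex.I • a) b : ℝ) : ℂ)) / 4 := by
  have hexp : ∀ x y : CSpace n, D x y = ∑ i, ∑ j,
      ((x i).re * (y j).re * D (Pi.single i 1) (Pi.single j 1)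
      + (x i).re * (y j).im * D (Pi.single i 1) (Pi.single j Complex.I)
      + (x i).im * (y j).re * D (Pi.single i Complex.I) (Pi.single j 1)
      + (x i).im * (y j).im * D (Pi.single i Complex.I) (Pi.single j Complex.I)) := by
    intro x y
    have h1 : D x y = ∑ i, ((x i).re * D (Pi.single i 1) y + (x i).im * D (Pi.single i Complex.I) y) := by
      conv_lhs => rw [eq_sum_re_im x]
      simp [map_sum]
    rw [h1]
    refine Finset.sum_congr rfl fun i _ => ?_
    rw [realLinear_apply (D (Pi.single i 1)) y, realLinear_apply (D (Pi.single i Complex.I)) y,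
      Finset.mul_sum, Finset.mul_sum, ← Finset.sum_add_distrib]
    exact Finset.sum_congr rfl fun j _ => by ring
  rw [hexp a b, hexp (Complex.I • a) (Complex.I • b), hexp a (Complex.I • b),
    hexp (Complex.I • a) b, ← Finset.sum_add_distrib, ← Finset.sum_sub_distrib]
  push_cast
  rw [Finset.mul_sum, ← Finset.sum_add_distrib, Finset.sum_div]
  refine Finset.sum_congr rfl fun i _ => ?_
  rw [← Finset.sum_add_distrib, ← Finset.sum_sub_distrib, Finset.mul_sum,
    ← Finset.sum_add_distrib, Finset.sum_div]
  refine Finset.sum_congr rfl fun j _ => ?_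
  rw [hH]
  simp only [Pi.smul_apply, smul_eq_mul, Complex.mul_re, Complex.mul_im, Complex.I_re,
    Complex.I_im, zero_mul, one_mul, zero_sub, zero_add]
  have hb : star (b j) = (b j).re - (b j).im * Complex.I := by
    apply Complex.ext <;> simp
  rw [hb]
  conv_lhs => rw [← Complex.re_add_im (a i)]
  push_cast
  ring_nf
  simp only [Complex.I_sq, Complex.I_pow_three]
  ring

theorem sesq_complexHessian (v : CSpace n → ℝ) (S : Set (CSpace n)) (z a b : CSpace n) :
    sesq (complexHessian v S z) a b =
      (((secondDeriv v S z a b + secondDeriv v S z (Complex.I • a) (Complex.I • b) : ℝ) : ℂ)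
      + Complex.I * ((secondDeriv v S z a (Complex.I • b)
        - secondDeriv v S z (Complex.I • a) b : ℝ) : ℂ)) / 4 :=
  sesq_of_bilin (fderivWithin ℝ (fun y => fderivWithin ℝ v S y) S z) (fun _ _ => rfl) a b

/-- Symmetry holds at interior points and extends to the boundary by continuity of the second
derivative, whence the closure hypothesis. -/
theorem secondDeriv_comm {v : CSpace n → ℝ} {S : Set (CSpace n)} {z : CSpace n}
    (hv : ContDiffOn ℝ 2 v S) (hS : UniqueDiffOn ℝ S) (hz : z ∈ closure (interior S))
    (hzS : z ∈ S) (a b : CSpace n) : secondDeriv v S z a b = secondDeriv v S z b a :=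
  ((hv z hzS).isSymmSndFDerivWithinAt (by simp) hS hz hzS) a b

theorem isHermitian_complexHessian {v : CSpace n → ℝ} {S : Set (CSpace n)} {z : CSpace n}
    (hv : ContDiffOn ℝ 2 v S) (hS : UniqueDiffOn ℝ S) (hz : z ∈ closure (interior S))
    (hzS : z ∈ S) : (complexHessian v S z).IsHermitian := by
  refine Matrix.IsHermitian.ext fun i j => ?_
  have hc := secondDeriv_comm hv hS hz hzS
  simp only [complexHessian, Matrix.of_apply]
  rw [hc (Pi.single j 1) (Pi.single i 1), hc (Pi.single j Complex.I) (Pi.single i Complex.I),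
    hc (Pi.single j 1) (Pi.single i Complex.I), hc (Pi.single j Complex.I) (Pi.single i 1)]
  apply Complex.ext <;> simp

theorem sesq_complexHessian_self {v : CSpace n → ℝ} {S : Set (CSpace n)} {z : CSpace n}
    (hv : ContDiffOn ℝ 2 v S) (hS : UniqueDiffOn ℝ S) (hz : z ∈ closure (interior S))
    (hzS : z ∈ S) (a : CSpace n) : sesq (complexHessian v S z) a a =
      (((secondDeriv v S z a a + secondDeriv v S z (Complex.I • a) (Complex.I • a)) / 4 : ℝ) : ℂ) := by
  rw [sesq_complexHessian, secondDeriv_comm hv hS hz hzS a (Complex.I • a)]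
  push_cast
  ring

theorem hasFDerivWithinAt_fderivWithin {v : CSpace n → ℝ} {S : Set (CSpace n)} {z : CSpace n}
    (hv : ContDiffOn ℝ 2 v S) (hS : UniqueDiffOn ℝ S) (hzS : z ∈ S) :
    HasFDerivWithinAt (fderivWithin ℝ v S)
      (fderivWithin ℝ (fun y => fderivWithin ℝ v S y) S z) S z :=
  (((hv.fderivWithin hS (m := 1) (by norm_num)).differentiableOn one_ne_zero) z
    hzS).hasFDerivWithinAt

theorem continuousOn_complexHessian {v : CSpace n → ℝ} {S : Set (CSpace n)}
    (hv : ContDiffOn ℝ 2 v S) (hS : UniqueDiffOn ℝ S) : ContinuousOn (complexHessian v S) S := by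
  have h1 : ContDiffOn ℝ 1 (fderivWithin ℝ v S) S := hv.fderivWithin hS (by norm_num)
  have h2 : ContinuousOn (fderivWithin ℝ (fun y => fderivWithin ℝ v S y) S) S :=
    h1.continuousOn_fderivWithin hS le_rfl
  have h3 : ∀ a b : CSpace n, ContinuousOn (fun z => secondDeriv v S z a b) S := fun a b =>
    (h2.clm_apply continuousOn_const).clm_apply continuousOn_const
  refine continuousOn_pi.2 fun i => continuousOn_pi.2 fun j => ?_
  simp only [complexHessian, Matrix.of_apply]
  refine ContinuousOn.div_const ?_ _
  refine ContinuousOn.add ?_ (continuousOn_const.mul ?_)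
  · exact Complex.continuous_ofReal.comp_continuousOn ((h3 _ _).add (h3 _ _))
  · exact Complex.continuous_ofReal.comp_continuousOn ((h3 _ _).sub (h3 _ _))

theorem secondDeriv_sub {u v : CSpace n → ℝ} {S : Set (CSpace n)} {z : CSpace n}
    (hu : ContDiffOn ℝ 2 u S) (hv : ContDiffOn ℝ 2 v S) (hS : UniqueDiffOn ℝ S) (hzS : z ∈ S)
    (a b : CSpace n) :
    secondDeriv (u - v) S z a b = secondDeriv u S z a b - secondDeriv v S z a b := by
  have h1 : ∀ y ∈ S, fderivWithin ℝ (u - v) S y = fderivWithin ℝ u S y - fderivWithin ℝ v S y :=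
    fun y hy => fderivWithin_sub (hS y hy) (hu.differentiableOn two_ne_zero y hy)
      (hv.differentiableOn two_ne_zero y hy)
  have h2 : fderivWithin ℝ (fun y => fderivWithin ℝ (u - v) S y) S z =
      fderivWithin ℝ (fun y => fderivWithin ℝ u S y) S z
        - fderivWithin ℝ (fun y => fderivWithin ℝ v S y) S z := by
    rw [fderivWithin_congr h1 (h1 z hzS)]
    exact fderivWithin_fun_sub (hS z hzS)
      (hasFDerivWithinAt_fderivWithin hu hS hzS).differentiableWithinAt
      (hasFDerivWithinAt_fderivWithin hv hS hzS).differentiableWithinAt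
  simp [secondDeriv, h2]

theorem complexHessian_sub {u v : CSpace n → ℝ} {S : Set (CSpace n)} {z : CSpace n}
    (hu : ContDiffOn ℝ 2 u S) (hv : ContDiffOn ℝ 2 v S) (hS : UniqueDiffOn ℝ S) (hzS : z ∈ S) :
    complexHessian u S z = complexHessian v S z + complexHessian (u - v) S z := by
  ext i j
  simp only [complexHessian, Matrix.of_apply, Matrix.add_apply, secondDeriv_sub hu hv hS hzS]
  push_cast
  ring

/-- A `C²` function that vanishes on a Levi flat boundary has vanishing complex Hessian on complex
tangent vectors. -/
theorem sesq_complexHessian_eq_zero {h ρ : CSpace n → ℝ} {S : Set (CSpace n)} {z : CSpace n}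
    (hh : ContDiffOn ℝ 2 h S) (hS : UniqueDiffOn ℝ S) (hρ : IsLocalDefiningFunction S z ρ)
    (hzS : z ∈ S) (hz0 : ρ z = 0) (hvan : ∀ w ∈ S, w ∉ interior S → h w = 0)
    (hlevi : ∀ a, dC ρ z (a, 0) = 0 → sesq (complexHessian ρ univ z) a a = 0)
    {a b : CSpace n} (ha : dC ρ z (a, 0) = 0) (hb : dC ρ z (b, 0) = 0) :
    sesq (complexHessian h S z) a b = 0 := by
  obtain ⟨V, hV, hzV, -, hSV, hdV⟩ := hρ.exists_isOpen
  obtain ⟨N, hN⟩ := hρ.exists_neg hz0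
  have hcl := hρ.mem_closure_interior hzS
  have hD1 : ContDiffAt ℝ 1 (fderiv ℝ ρ) z := hρ.contDiffAt.fderiv_right (by norm_num)
  have hess : ∀ a, fderiv ℝ ρ z a = 0 → secondDeriv h S z a a
      + secondDeriv ρ univ z a a * fderivWithin ℝ h S z N = 0 := by
    intro a ha
    have := hessian_of_vanishing (S := S) (V := V) (z := z) (ρ := ρ) (h := h)
      (ρ' := fderiv ℝ ρ) (h' := fderivWithin ℝ h S) (ρ'' := fderiv ℝ (fderiv ℝ ρ) z)
      (h'' := fderivWithin ℝ (fun y => fderivWithin ℝ h S y) S z) hV hzV hSV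
      (fun w hw => (hdV w hw).hasFDerivAt)
      (hD1.differentiableAt one_ne_zero).hasFDerivAt
      (fun w hw => ((hh.differentiableOn two_ne_zero w hw.1).hasFDerivWithinAt).mono
        inter_subset_left)
      ((hasFDerivWithinAt_fderivWithin hh hS hzS).mono inter_subset_left) hz0
      (fun w hw hw0 => hvan w
        ((hSV.symm ▸ ⟨hw, hw0.le⟩ : w ∈ S ∩ V).1) ((hdV w hw).notMem_interior hw0)) ha hN
    simpa [secondDeriv, fderivWithin_univ] using this
  have hρdiag : ∀ a, dC ρ z (a, 0) = 0 →
      secondDeriv ρ univ z a a + secondDeriv ρ univ z (Complex.I • a) (Complex.I • a) = 0 := by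
    intro a ha
    have h1 := hlevi a ha
    rw [sesq_complexHessian] at h1
    have h2 := congrArg Complex.re h1
    simpa using h2
  have hadd : ∀ a b, dC ρ z (a, 0) = 0 → dC ρ z (b, 0) = 0 → dC ρ z (a + b, 0) = 0 := by
    intro a b ha hb
    rw [dC_eq_zero_iff] at ha hb ⊢
    simp [smul_add, ha.1, ha.2, hb.1, hb.2]
  have hsmul : ∀ a, dC ρ z (a, 0) = 0 → dC ρ z (Complex.I • a, 0) = 0 := by
    intro a ha
    rw [dC_eq_zero_iff] at ha ⊢
    refine ⟨ha.2, ?_⟩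
    rw [smul_smul, Complex.I_mul_I, neg_one_smul, map_neg, ha.1, neg_zero]
  refine sesq_eq_zero_of_diag (P := fun a => dC ρ z (a, 0) = 0) hadd hsmul ?_ ha hb
  intro a ha
  rw [sesq_complexHessian_self hh hS hcl hzS]
  have h1 := hess a ((dC_eq_zero_iff ρ z a).1 ha).1
  have h2 := hess _ ((dC_eq_zero_iff ρ z a).1 ha).2
  have h3 := hρdiag a ha
  -- The identities for `a` and `i a` carry the same normal derivative of `h`, and its total
  -- coefficient is four times the Levi form of `ρ`, which is zero.
  have h4 : secondDeriv h S z a a + secondDeriv h S z (Complex.I • a) (Complex.I • a) = 0 := by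
    linear_combination h1 + h2 - (fderivWithin ℝ h S z N) * h3
  rw [h4]
  simp

end Hessian

/-! ### Eigenvalues of Hermitian matrices -/

section Matrices

open Polynomial Matrix

variable {n : ℕ}

/-- Bijections between corresponding fibres glue to a permutation. -/
theorem exists_perm_of_card_fiber {α β : Type*} [Fintype α] [DecidableEq β] {f g : α → β}
    (h : ∀ c, Fintype.card {x // f x = c} = Fintype.card {x // g x = c}) :
    ∃ σ : Equiv.Perm α, f = g ∘ σ := by
  refine ⟨(Equiv.sigmaFiberEquiv f).symm.trans ((Equiv.sigmaCongrRight fun c =>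
    Fintype.equivOfCardEq (h c)).trans (Equiv.sigmaFiberEquiv g)), ?_⟩
  funext x
  exact ((Fintype.equivOfCardEq (h (f x)) ⟨x, rfl⟩).2).symm

/-- The factors of a split polynomial are determined up to order. -/
theorem exists_perm_of_prod_eq {l l' : Fin n → ℝ}
    (h : ∏ i, (X - C (l i : ℂ)) = ∏ i, (X - C (l' i : ℂ))) : ∃ σ : Equiv.Perm (Fin n), l = l' ∘ σ := by
  have hr : ∀ l : Fin n → ℝ, (∏ i, (X - C (l i : ℂ))).roots
      = Finset.univ.val.map fun i => (l i : ℂ) := fun l => by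
    have := roots_multiset_prod_X_sub_C (Finset.univ.val.map fun i => (l i : ℂ))
    rwa [Multiset.map_map] at this
  have hm := congrArg Polynomial.roots h
  rw [hr, hr] at hm
  refine exists_perm_of_card_fiber fun c => ?_
  have hc := congrArg (Multiset.count (c : ℂ)) hm
  simp only [Multiset.count_map, Complex.ofReal_inj] at hc
  rw [Fintype.card_subtype, Fintype.card_subtype]
  simpa [Finset.card_def, eq_comm] using hc

/-- Both the rows and the columns of a unitary matrix are unit vectors. -/
theorem sq_norm_mem_doublyStochastic {V : Matrix (Fin n) (Fin n) ℂ}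
    (hV : V ∈ Matrix.unitaryGroup (Fin n) ℂ) :
    (Matrix.of fun i j => ‖V i j‖ ^ 2 : Matrix (Fin n) (Fin n) ℝ) ∈ doublyStochastic ℝ (Fin n) := by
  have hsq : ∀ w : ℂ, ((‖w‖ ^ 2 : ℝ) : ℂ) = w * star w := fun w => by
    rw [Complex.star_def, Complex.mul_conj, Complex.normSq_eq_norm_sq]
  rw [mem_doublyStochastic_iff_sum]
  refine ⟨fun i j => by simp only [Matrix.of_apply]; positivity, fun i => ?_, fun j => ?_⟩
  · have h := congrFun (congrFun (Matrix.mem_unitaryGroup_iff.1 hV) i) i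
    simp only [Matrix.mul_apply, Matrix.star_apply, Matrix.one_apply_eq] at h
    apply Complex.ofReal_injective
    simp only [Matrix.of_apply, Complex.ofReal_sum, hsq]
    exact_mod_cast h
  · have h := congrFun (congrFun (Matrix.mem_unitaryGroup_iff'.1 hV) j) j
    simp only [Matrix.mul_apply, Matrix.star_apply, Matrix.one_apply_eq] at h
    apply Complex.ofReal_injective
    simp only [Matrix.of_apply, Complex.ofReal_sum, hsq]
    simp_rw [mul_comm (V _ j)]
    exact_mod_cast h

/-- Frames are stored as the rows of `P`, so a change of frame is `P A Pᴴ`. -/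
theorem sesq_eq_mul (A P : Matrix (Fin n) (Fin n) ℂ) (i j : Fin n) :
    sesq A (P i) (P j) = (P * A * Pᴴ) i j := by
  simp only [sesq, Matrix.mul_apply, Matrix.conjTranspose_apply, Finset.sum_mul]
  rw [Finset.sum_comm]
  exact Finset.sum_congr rfl fun k _ => Finset.sum_congr rfl fun l _ => by ring

/-- The characteristic polynomial of `G⁻¹ A` in a `G`-orthonormal frame. -/
theorem charpoly_eq_of_orthonormal {G : Matrix (Fin n) (Fin n) ℂ} (A : Matrix (Fin n) (Fin n) ℂ)
    {P : Matrix (Fin n) (Fin n) ℂ}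
    (hP : ∀ i j, sesq G (P i) (P j) = if i = j then 1 else 0) :
    (G⁻¹ * A).charpoly = (P * A * Pᴴ).charpoly := by
  have h1 : P * (G * Pᴴ) = 1 := by
    ext i j
    rw [← Matrix.mul_assoc, ← sesq_eq_mul, hP, Matrix.one_apply]
  have h2 : G * (Pᴴ * P) = 1 := by rw [← Matrix.mul_assoc]; exact mul_eq_one_comm.1 h1
  rw [Matrix.inv_eq_right_inv h2, Matrix.mul_assoc, Matrix.charpoly_mul_comm]

theorem eq_diagonal_conj {A : Matrix (Fin n) (Fin n) ℂ} (hA : A.IsHermitian) :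
    ∃ Q ∈ Matrix.unitaryGroup (Fin n) ℂ,
      Q * A * Qᴴ = Matrix.diagonal fun i => (hA.eigenvalues i : ℂ) := by
  refine ⟨star (hA.eigenvectorUnitary : Matrix (Fin n) (Fin n) ℂ),
    (star hA.eigenvectorUnitary).2, ?_⟩
  have hU : star (hA.eigenvectorUnitary : Matrix (Fin n) (Fin n) ℂ) * hA.eigenvectorUnitary = 1 :=
    Matrix.mem_unitaryGroup_iff'.1 hA.eigenvectorUnitary.2
  have hs := hA.spectral_theorem
  rw [Unitary.conjStarAlgAut_apply] at hs
  have hd : Matrix.diagonal (RCLike.ofReal ∘ hA.eigenvalues)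
      = Matrix.diagonal fun i => (hA.eigenvalues i : ℂ) := rfl
  rw [hd] at hs
  generalize (hA.eigenvectorUnitary : Matrix (Fin n) (Fin n) ℂ) = U at hU hs ⊢
  generalize (Matrix.diagonal fun i => (hA.eigenvalues i : ℂ)) = Λ at hs ⊢
  rw [hs, ← Matrix.star_eq_conjTranspose, star_star]
  calc _ = (star U * U) * Λ * (star U * U) := by noncomm_ring
    _ = _ := by rw [hU, one_mul, mul_one]

/-- Schur: the diagonal entries in an orthonormal frame are averages of the eigenvalues. -/
theorem exists_doublyStochastic_sesq {B : Matrix (Fin n) (Fin n) ℂ} (hB : B.IsHermitian)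
    {Q : Matrix (Fin n) (Fin n) ℂ} (hQ : Q ∈ Matrix.unitaryGroup (Fin n) ℂ) :
    ∃ D ∈ doublyStochastic ℝ (Fin n),
      ∀ i, sesq B (Q i) (Q i) = ((D *ᵥ hB.eigenvalues) i : ℝ) := by
  obtain ⟨R, hR, hRB⟩ := eq_diagonal_conj hB
  have hR' : Rᴴ * R = 1 := Matrix.mem_unitaryGroup_iff'.1 hR
  have hV : Q * Rᴴ ∈ Matrix.unitaryGroup (Fin n) ℂ := mul_mem hQ (Unitary.star_mem hR)
  refine ⟨_, sq_norm_mem_doublyStochastic hV, fun i => ?_⟩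
  -- With `V = Q Rᴴ`, the diagonal entries are `∑ⱼ |Vᵢⱼ|² λⱼ`.
  have hB' : Q * B * Qᴴ = (Q * Rᴴ) * (Matrix.diagonal fun i => (hB.eigenvalues i : ℂ))
      * (Q * Rᴴ)ᴴ := by
    rw [← hRB, Matrix.conjTranspose_mul, Matrix.conjTranspose_conjTranspose]
    calc Q * B * Qᴴ = Q * 1 * B * (1 * Qᴴ) := by rw [mul_one, one_mul]
      _ = _ := by rw [← hR']; noncomm_ring
  rw [sesq_eq_mul, hB', Matrix.mul_apply]
  simp only [Matrix.mul_diagonal, Matrix.conjTranspose_apply, Matrix.mulVec, dotProduct,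
    Matrix.of_apply]
  push_cast
  refine Finset.sum_congr rfl fun j _ => ?_
  have : ((‖(Q * Rᴴ) i j‖ : ℂ)) ^ 2 = (Q * Rᴴ) i j * star ((Q * Rᴴ) i j) := by
    rw [Complex.star_def, Complex.mul_conj, Complex.normSq_eq_norm_sq]
    push_cast; rfl
  rw [this]; ring

/-- This is Birkhoff's theorem: `D` is a convex combination of permutation matrices. -/
theorem mulVec_mem_convexHull {D : Matrix (Fin n) (Fin n) ℝ} (hD : D ∈ doublyStochastic ℝ (Fin n))
    (l : Fin n → ℝ) : D *ᵥ l ∈ convexHull ℝ (range fun σ : Equiv.Perm (Fin n) => l ∘ σ) := by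
  obtain ⟨w, hw, hw1, rfl⟩ := exists_eq_sum_perm_of_mem_doublyStochastic hD
  rw [Matrix.sum_mulVec]
  simp only [Matrix.smul_mulVec, Matrix.permMatrix_mulVec]
  refine (convex_convexHull ℝ _).sum_mem (fun σ _ => hw σ) hw1 fun σ _ => ?_
  exact subset_convexHull ℝ _ ⟨σ, rfl⟩

/-- A lower bound for the quadratic form of `A` by that of a matrix `B` with the same upper left block,
when the last diagonal entry of `A` is large. Here `x'` is `x` with the last entry negated. -/
theorem re_sesq_ge {m : ℕ} {A B : Matrix (Fin (m + 1)) (Fin (m + 1)) ℂ} (hA : A.IsHermitian)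
    (hAB : ∀ α β : Fin m, A α.castSucc β.castSucc = B α.castSucc β.castSucc) {ε : ℝ} (hε : 0 < ε)
    (hlarge : (B (Fin.last m) (Fin.last m)).re + 1
      + (∑ α : Fin m, ‖A α.castSucc (Fin.last m)‖ ^ 2) / ε ≤ (A (Fin.last m) (Fin.last m)).re)
    {x x' : CSpace (m + 1)} (hx : ∀ α : Fin m, x' α.castSucc = x α.castSucc)
    (hxn : x' (Fin.last m) = -x (Fin.last m)) :
    ((sesq B x x).re + (sesq B x' x').re) / 2 + ‖x (Fin.last m)‖ ^ 2 - ε * ∑ i, ‖x i‖ ^ 2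
      ≤ (sesq A x x).re := by
  have hexp : ∀ (H : Matrix (Fin (m + 1)) (Fin (m + 1)) ℂ) (y : CSpace (m + 1)), sesq H y y =
      ∑ α : Fin m, ∑ β : Fin m, H α.castSucc β.castSucc * (y α.castSucc * star (y β.castSucc))
      + ∑ α : Fin m, H α.castSucc (Fin.last m) * (y α.castSucc * star (y (Fin.last m)))
      + ∑ α : Fin m, H (Fin.last m) α.castSucc * (y (Fin.last m) * star (y α.castSucc))
      + H (Fin.last m) (Fin.last m) * (y (Fin.last m) * star (y (Fin.last m))) := by
    intro H y
    simp only [sesq, Fin.sum_univ_castSucc, Finset.sum_add_distrib]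
    ring
  rw [hexp A x, hexp B x, hexp B x']
  -- Negating the last coordinate flips the sign of the mixed terms of `B` only, so they cancel in
  -- the average of the two forms.
  simp only [hx, hxn, star_neg, mul_neg, neg_mul, neg_neg, Finset.sum_neg_distrib, hAB]
  generalize (∑ α : Fin m, ∑ β : Fin m,
    B α.castSucc β.castSucc * (x α.castSucc * star (x β.castSucc))) = s
  have hnn : ∀ (w y : ℂ), (w * (y * star y)).re = w.re * ‖y‖ ^ 2 := by
    intro w y
    rw [Complex.star_def, Complex.mul_conj, Complex.normSq_eq_norm_sq, Complex.re_mul_ofReal]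
  simp only [Complex.add_re, Complex.neg_re, hnn, Complex.re_sum]
  have hsym : ∀ α : Fin m, (A (Fin.last m) α.castSucc * (x (Fin.last m) * star (x α.castSucc))).re
      = (A α.castSucc (Fin.last m) * (x α.castSucc * star (x (Fin.last m)))).re := by
    intro α
    rw [← hA.apply, ← Complex.conj_re, ← Complex.star_def]
    congr 1
    simp only [star_mul', star_star]
    ring
  simp only [hsym]
  -- Weighted arithmetic-geometric inequality for the mixed terms of `A`: the part with `‖x_α‖²`
  -- costs `ε`, and the part with `‖x_n‖²` is absorbed by `A_nn`.
  have hcs : ∀ α : Fin m, -(ε * ‖x α.castSucc‖ ^ 2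
      + ‖A α.castSucc (Fin.last m)‖ ^ 2 / ε * ‖x (Fin.last m)‖ ^ 2)
      ≤ 2 * (A α.castSucc (Fin.last m) * (x α.castSucc * star (x (Fin.last m)))).re := by
    intro α
    have h1 := Complex.abs_re_le_norm (A α.castSucc (Fin.last m) *
      (x α.castSucc * star (x (Fin.last m))))
    rw [norm_mul, norm_mul, norm_star] at h1
    have h2 := neg_le_of_abs_le h1
    have h3 : 0 ≤ (ε * ‖x α.castSucc‖ - ‖A α.castSucc (Fin.last m)‖ * ‖x (Fin.last m)‖) ^ 2 / ε := by
      positivity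
    have h4 : (ε * ‖x α.castSucc‖ - ‖A α.castSucc (Fin.last m)‖ * ‖x (Fin.last m)‖) ^ 2 / ε
        = ε * ‖x α.castSucc‖ ^ 2 + ‖A α.castSucc (Fin.last m)‖ ^ 2 / ε * ‖x (Fin.last m)‖ ^ 2
          - 2 * (‖A α.castSucc (Fin.last m)‖ * (‖x α.castSucc‖ * ‖x (Fin.last m)‖)) := by
      field_simp
      ring
    linarith
  have hsum := Finset.sum_le_sum fun α (_ : α ∈ Finset.univ) => hcs α
  rw [Finset.sum_neg_distrib, Finset.sum_add_distrib, ← Finset.mul_sum, ← Finset.mul_sum,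
    ← Finset.sum_mul, ← Finset.sum_div] at hsum
  have hlast := mul_le_mul_of_nonneg_right hlarge (sq_nonneg ‖x (Fin.last m)‖)
  have hpos : 0 ≤ ε * ‖x (Fin.last m)‖ ^ 2 := by positivity
  rw [Fin.sum_univ_castSucc (fun i => ‖x i‖ ^ 2)]
  linarith

end Matrices

/-! ### Symmetric concave functions on cones -/

section Cone

variable {n : ℕ} {Γ : Set (Fin n → ℝ)} {f : (Fin n → ℝ) → ℝ}

theorem IsSymmetricCone.add_mem (hΓ : IsSymmetricCone Γ) {x y : Fin n → ℝ} (hx : x ∈ Γ)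
    (hy : y ∈ Γ) : x + y ∈ Γ := by
  have h := hΓ.convex hx hy (a := 1 / 2) (b := 1 / 2) (by norm_num) (by norm_num) (by norm_num)
  have h2 := hΓ.cone _ h 2 (by norm_num)
  rw [smul_add, smul_smul, smul_smul] at h2
  norm_num at h2
  exact h2

/-- Since `Γ` is open, a small multiple of `(1, …, 1)` can be moved from `x` to `d`, making the
second summand strictly positive. -/
theorem IsSymmetricCone.add_nonneg_mem (hΓ : IsSymmetricCone Γ) {x d : Fin n → ℝ} (hx : x ∈ Γ)
    (hd : ∀ i, 0 ≤ d i) : x + d ∈ Γ := by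
  have hc : Tendsto (fun ε : ℝ => x - ε • (1 : Fin n → ℝ)) (𝓝[>] 0) (𝓝 x) := by
    have : Continuous fun ε : ℝ => x - ε • (1 : Fin n → ℝ) := by fun_prop
    exact (this.tendsto' 0 x (by simp)).mono_left nhdsWithin_le_nhds
  obtain ⟨ε, hε, hε0⟩ := ((hc.eventually (hΓ.isOpen.mem_nhds hx)).and self_mem_nhdsWithin).exists
  have hε0' : (0 : ℝ) < ε := hε0
  have hpos := hΓ.positive_subset (d + ε • (1 : Fin n → ℝ)) fun i => by
    have := hd i
    simp only [Pi.add_apply, Pi.smul_apply, Pi.one_apply, smul_eq_mul, mul_one]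
    linarith
  have := hΓ.add_mem hε hpos
  rwa [sub_add_add_cancel, add_comm x d, add_comm d x] at this

theorem IsStructureFunction.lt_add (hΓ : IsSymmetricCone Γ) (hf : IsStructureFunction Γ f)
    {x d : Fin n → ℝ} (hx : x ∈ Γ) (hd : ∀ i, 0 ≤ d i) (hd0 : d ≠ 0) : f x < f (x + d) := by
  have hmem : ∀ t ∈ Icc (0 : ℝ) 1, x + t • d ∈ Γ := fun t ht =>
    hΓ.add_nonneg_mem hx fun i => mul_nonneg ht.1 (hd i)
  have hder : ∀ t ∈ Icc (0 : ℝ) 1,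
      HasDerivAt (fun t : ℝ => f (x + t • d)) (fderiv ℝ f (x + t • d) d) t := by
    intro t ht
    have hfd : HasFDerivAt f (fderiv ℝ f (x + t • d)) (x + t • d) :=
      ((hf.smooth.contDiffAt (hΓ.isOpen.mem_nhds (hmem t ht))).differentiableAt
        (by simp)).hasFDerivAt
    have hline : HasDerivAt (fun t : ℝ => x + t • d) d t := by
      simpa using ((hasDerivAt_id t).smul_const d).const_add x
    exact hfd.comp_hasDerivAt t hline
  have hmono : StrictMonoOn (fun t : ℝ => f (x + t • d)) (Icc 0 1) := by
    refine strictMonoOn_of_deriv_pos (convex_Icc _ _)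
      (fun t ht => (hder t ht).continuousAt.continuousWithinAt) fun t ht => ?_
    have ht' := interior_subset ht
    rw [(hder t ht').deriv]
    have hsum : d = ∑ i, d i • (Pi.single i 1 : Fin n → ℝ) := by
      funext j
      simp [Finset.sum_apply, Pi.single_apply]
    obtain ⟨j, hj⟩ := Function.ne_iff.1 hd0
    have hfd : fderiv ℝ f (x + t • d) d = ∑ i, fderiv ℝ f (x + t • d)
        (d i • (Pi.single i 1 : Fin n → ℝ)) := by rw [← map_sum, ← hsum]
    rw [hfd]
    refine Finset.sum_pos' (fun i _ => ?_) ⟨j, Finset.mem_univ j, ?_⟩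
    · rw [map_smul]
      exact mul_nonneg (hd i) (hf.elliptic _ (hmem t ht') i).le
    · rw [map_smul]
      exact mul_pos (lt_of_le_of_ne (hd j) (Ne.symm hj)) (hf.elliptic _ (hmem t ht') j)
  simpa using hmono (left_mem_Icc.2 zero_le_one) (right_mem_Icc.2 zero_le_one) zero_lt_one

theorem IsStructureFunction.mono (hΓ : IsSymmetricCone Γ) (hf : IsStructureFunction Γ f)
    {x y : Fin n → ℝ} (hx : x ∈ Γ) (hxy : ∀ i, x i ≤ y i) : y ∈ Γ ∧ f x ≤ f y := by
  have hd : ∀ i, 0 ≤ (y - x) i := fun i => sub_nonneg.2 (hxy i)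
  have hy : x + (y - x) = y := by abel
  refine ⟨hy ▸ hΓ.add_nonneg_mem hx hd, ?_⟩
  by_cases h0 : y - x = 0
  · rw [sub_eq_zero.1 h0]
  · exact (hy ▸ hf.lt_add hΓ hx hd h0).le

/-- All averages of the reorderings of an element of `K`. -/
def symmHull (K : Set (Fin n → ℝ)) : Set (Fin n → ℝ) :=
  (fun q : (Equiv.Perm (Fin n) → ℝ) × (Fin n → ℝ) => ∑ σ, q.1 σ • (q.2 ∘ σ)) ''
    (stdSimplex ℝ (Equiv.Perm (Fin n)) ×ˢ K)

/-- Parametrizing by weights and a single point of `K` presents the set as a continuous image of a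
compact product. Its compactness makes `ε` and `R` uniform. -/
theorem isCompact_symmHull {K : Set (Fin n → ℝ)} (hK : IsCompact K) : IsCompact (symmHull K) := by
  refine ((isCompact_stdSimplex ℝ _).prod hK).image ?_
  refine continuous_finsetSum _ fun σ _ =>
    ((continuous_apply σ).comp continuous_fst).smul ?_
  exact continuous_pi fun i => (continuous_apply (σ i)).comp continuous_snd

theorem symmHull_subset (hΓ : IsSymmetricCone Γ) {K : Set (Fin n → ℝ)} (hK : K ⊆ Γ) :
    symmHull K ⊆ Γ := by
  rintro _ ⟨⟨w, l⟩, ⟨hw, hl⟩, rfl⟩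
  exact hΓ.convex.sum_mem (fun σ _ => hw.1 σ) hw.2 fun σ _ => hΓ.symmetric l (hK hl) σ

theorem convexHull_range_comp_subset {K : Set (Fin n → ℝ)} {l : Fin n → ℝ} (hl : l ∈ K) :
    convexHull ℝ (range fun σ : Equiv.Perm (Fin n) => l ∘ σ) ⊆ symmHull K := by
  have hconv : Convex ℝ (Fintype.linearCombination ℝ (fun σ : Equiv.Perm (Fin n) => l ∘ σ) ''
      stdSimplex ℝ (Equiv.Perm (Fin n))) := (convex_stdSimplex ℝ _).linear_image _
  have hsub : (range fun σ : Equiv.Perm (Fin n) => l ∘ σ) ⊆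
      Fintype.linearCombination ℝ (fun σ : Equiv.Perm (Fin n) => l ∘ σ) ''
        stdSimplex ℝ (Equiv.Perm (Fin n)) := by
    rintro _ ⟨σ, rfl⟩
    exact ⟨Pi.single σ 1, single_mem_stdSimplex ℝ σ, by
      rw [Fintype.linearCombination_apply_single, one_smul]⟩
  refine (convexHull_min hsub hconv).trans ?_
  rintro _ ⟨w, hw, rfl⟩
  exact ⟨(w, l), ⟨hw, hl⟩, rfl⟩

/-- The superlevel set of the concave `f` is convex and, by symmetry, contains every reordering of
`l`. -/
theorem IsStructureFunction.le_of_mem_convexHull (hΓ : IsSymmetricCone Γ)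
    (hf : IsStructureFunction Γ f) {l x : Fin n → ℝ} (hl : l ∈ Γ)
    (hx : x ∈ convexHull ℝ (range fun σ : Equiv.Perm (Fin n) => l ∘ σ)) : f l ≤ f x := by
  have hsub : (range fun σ : Equiv.Perm (Fin n) => l ∘ σ) ⊆ {y ∈ Γ | f l ≤ f y} := by
    rintro _ ⟨σ, rfl⟩
    exact ⟨hΓ.symmetric l hl σ, (hf.symmetric l hl σ).ge⟩
  exact (convexHull_min hsub (hf.concave.convex_ge (f l)) hx).2

/-- On a compact subset of `Γ`, adding a probability vector increases `f` by more than subtracting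
a small multiple of `(1, …, 1)` decreases it. -/
theorem IsStructureFunction.exists_pos_lt (hΓ : IsSymmetricCone Γ) (hf : IsStructureFunction Γ f)
    {K : Set (Fin n → ℝ)} (hK : IsCompact K) (hKΓ : K ⊆ Γ) :
    ∃ ε : ℝ, 0 < ε ∧ ∀ μ ∈ K, ∀ d ∈ stdSimplex ℝ (Fin n),
      μ + d - ε • (1 : Fin n → ℝ) ∈ Γ ∧ f μ < f (μ + d - ε • (1 : Fin n → ℝ)) := by
  set F : ((Fin n → ℝ) × (Fin n → ℝ)) × ℝ → (Fin n → ℝ) :=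
    fun q => q.1.1 + q.1.2 - q.2 • (1 : Fin n → ℝ) with hF
  have hFc : Continuous F := by rw [hF]; fun_prop
  have hfc : ContinuousOn f Γ := hf.smooth.continuousOn
  have hmem : ∀ μ ∈ K, ∀ d ∈ stdSimplex ℝ (Fin n), ∀ᶠ q in 𝓝 (((μ, d), (0 : ℝ))),
      F q ∈ Γ ∧ f q.1.1 < f (F q) := by
    intro μ hμ d hd
    have hF0 : F ((μ, d), 0) = μ + d := by simp [hF]
    have hΓd : μ + d ∈ Γ := hΓ.add_nonneg_mem (hKΓ hμ) hd.1
    have hd0 : d ≠ 0 := by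
      rintro rfl
      have := hd.2
      simp at this
    have hlt := hf.lt_add hΓ (hKΓ hμ) hd.1 hd0
    have h1 : ContinuousAt (fun q : ((Fin n → ℝ) × (Fin n → ℝ)) × ℝ => f q.1.1) ((μ, d), 0) :=
      ContinuousAt.comp (f := fun q : ((Fin n → ℝ) × (Fin n → ℝ)) × ℝ => q.1.1)
        (hfc.continuousAt (hΓ.isOpen.mem_nhds (hKΓ hμ))) (by fun_prop)
    have h2 : ContinuousAt (fun q => f (F q)) ((μ, d), 0) :=
      ContinuousAt.comp (by rw [hF0]; exact hfc.continuousAt (hΓ.isOpen.mem_nhds hΓd))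
        hFc.continuousAt
    have h3 : ∀ᶠ q in 𝓝 (((μ, d), (0 : ℝ))), F q ∈ Γ :=
      hFc.continuousAt.eventually (hΓ.isOpen.mem_nhds (by rw [hF0]; exact hΓd))
    exact h3.and (h1.eventually_lt h2 (by simpa [hF0] using hlt))
  -- At `ε = 0` the strict inequality is `lt_add`; the tube lemma makes it hold for one positive `ε`
  -- over the whole compact set of pairs `(μ, d)`.
  obtain ⟨u, v, -, hv, hu, h0v, huv⟩ := generalized_tube_lemma
    (hK.prod (isCompact_stdSimplex ℝ (Fin n))) (isCompact_singleton (x := (0 : ℝ)))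
    (n := interior {q | F q ∈ Γ ∧ f q.1.1 < f (F q)}) isOpen_interior (by
      rintro ⟨⟨μ, d⟩, t⟩ ⟨⟨hμ, hd⟩, ht⟩
      have ht0 : t = 0 := ht
      subst ht0
      exact mem_interior_iff_mem_nhds.2 (hmem μ hμ d hd))
  obtain ⟨δ, hδ, hb⟩ := Metric.isOpen_iff.1 hv 0 (h0v rfl)
  refine ⟨δ / 2, half_pos hδ, fun μ hμ d hd => ?_⟩
  have hδv : δ / 2 ∈ v := hb (by
    rw [Metric.mem_ball, Real.dist_eq, sub_zero, abs_of_pos (half_pos hδ)]; linarith)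
  have hq := interior_subset (huv (mk_mem_prod (hu (mk_mem_prod hμ hd)) hδv))
  exact hq

open Polynomial Matrix in
/-- If two Hermitian matrices agree except in the last row and column, then `f` of the eigenvalues
grows strictly once the last diagonal entry is large compared with the other changed entries. -/
theorem IsStructureFunction.lt_of_large {m : ℕ} {Γ : Set (Fin (m + 1) → ℝ)}
    {f : (Fin (m + 1) → ℝ) → ℝ} (hΓ : IsSymmetricCone Γ) (hf : IsStructureFunction Γ f)
    {K : Set (Fin (m + 1) → ℝ)} (hK : IsCompact K) (hKΓ : K ⊆ Γ) :
    ∃ R ε : ℝ, 0 < R ∧ 0 < ε ∧ ∀ A B : Matrix (Fin (m + 1)) (Fin (m + 1)) ℂ, ∀ hA : A.IsHermitian,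
      B.IsHermitian →
      (∀ α β : Fin m, A α.castSucc β.castSucc = B α.castSucc β.castSucc) →
      ∀ l ∈ K, B.charpoly = ∏ i, (X - C (l i : ℂ)) →
      R + (∑ α : Fin m, ‖A α.castSucc (Fin.last m)‖ ^ 2) / ε
        ≤ (A (Fin.last m) (Fin.last m)).re →
      hA.eigenvalues ∈ Γ ∧ f l < f hA.eigenvalues := by
  have hcompact := isCompact_symmHull hK
  have hsub := symmHull_subset hΓ hKΓ
  obtain ⟨ε, hε, hlt⟩ := hf.exists_pos_lt hΓ hcompact hsub
  obtain ⟨R, hR⟩ := hcompact.isBounded.exists_norm_le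
  -- `|R|` bounds `B_nn`, which is itself an average of the eigenvalues of `B`; the extra `1` yields
  -- the gain `‖x_n‖²` that becomes `d`.
  refine ⟨|R| + 1, ε, by positivity, hε, fun A B hA hB hAB l hl hchar hlarge => ?_⟩
  rw [hB.charpoly_eq] at hchar
  obtain ⟨σ, hσ⟩ := exists_perm_of_prod_eq (l := hB.eigenvalues) (l' := l) hchar
  have hhull : ∀ D ∈ doublyStochastic ℝ (Fin (m + 1)), D *ᵥ hB.eigenvalues ∈
      convexHull ℝ (range fun τ : Equiv.Perm (Fin (m + 1)) => l ∘ τ) := by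
    intro D hD
    have h := mulVec_mem_convexHull hD hB.eigenvalues
    rw [hσ] at h ⊢
    refine convexHull_mono ?_ h
    rintro _ ⟨τ, rfl⟩
    exact ⟨τ.trans σ, rfl⟩
  -- the last diagonal entry of `B`
  have hBn : (B (Fin.last m) (Fin.last m)).re ≤ |R| := by
    obtain ⟨D, hD, hDB⟩ := exists_doublyStochastic_sesq hB
      (one_mem (Matrix.unitaryGroup (Fin (m + 1)) ℂ))
    have h1 := hDB (Fin.last m)
    rw [sesq_eq_mul, Matrix.one_mul, Matrix.conjTranspose_one, Matrix.mul_one] at h1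
    rw [h1, Complex.ofReal_re]
    have h2 := hR _ (convexHull_range_comp_subset hl (hhull D hD))
    exact (le_abs_self _).trans ((norm_le_pi_norm (D *ᵥ hB.eigenvalues) _).trans
      (h2.trans (le_abs_self R)))
  obtain ⟨Q, hQ, hQA⟩ := eq_diagonal_conj hA
  -- The reflection `diag(1, …, 1, -1)` is unitary, so the reflected eigenframe of `A` also gives
  -- averages of the eigenvalues of `B`.
  set s : Fin (m + 1) → ℂ := Function.update 1 (Fin.last m) (-1) with hs
  have hsc : ∀ α : Fin m, s α.castSucc = 1 := fun α => by
    rw [hs, Function.update_of_ne (Fin.castSucc_lt_last α).ne]; rfl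
  have hsn : s (Fin.last m) = -1 := by rw [hs, Function.update_self]
  have hS : Matrix.diagonal s ∈ Matrix.unitaryGroup (Fin (m + 1)) ℂ := by
    rw [Matrix.mem_unitaryGroup_iff, Matrix.star_eq_conjTranspose,
      Matrix.diagonal_conjTranspose, Matrix.diagonal_mul_diagonal, ← Matrix.diagonal_one]
    congr 1
    funext i
    refine Fin.lastCases ?_ (fun α => ?_) i
    · simp [hsn]
    · simp [hsc]
  obtain ⟨D₁, hD₁, hD₁B⟩ := exists_doublyStochastic_sesq hB hQ
  obtain ⟨D₂, hD₂, hD₂B⟩ := exists_doublyStochastic_sesq hB (mul_mem hQ hS)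
  have hdsQ := sq_norm_mem_doublyStochastic hQ
  set μ : Fin (m + 1) → ℝ :=
    (1 / 2 : ℝ) • (D₁ *ᵥ hB.eigenvalues) + (1 / 2 : ℝ) • (D₂ *ᵥ hB.eigenvalues) with hμ
  set d : Fin (m + 1) → ℝ := fun i => ‖Q i (Fin.last m)‖ ^ 2 with hd
  have hμmem : μ ∈ convexHull ℝ (range fun τ : Equiv.Perm (Fin (m + 1)) => l ∘ τ) :=
    convex_convexHull ℝ _ (hhull D₁ hD₁) (hhull D₂ hD₂) (by norm_num) (by norm_num) (by norm_num)
  have hdmem : d ∈ stdSimplex ℝ (Fin (m + 1)) :=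
    ⟨fun i => by positivity, sum_col_of_mem_doublyStochastic hdsQ (Fin.last m)⟩
  obtain ⟨hmemΓ, hflt⟩ := hlt μ (convexHull_range_comp_subset hl hμmem) d hdmem
  have hle : ∀ i, (μ + d - ε • (1 : Fin (m + 1) → ℝ)) i ≤ hA.eigenvalues i := by
    intro i
    have hQi : ((sesq A (Q i) (Q i)).re) = hA.eigenvalues i := by
      rw [sesq_eq_mul, hQA, Matrix.diagonal_apply_eq, Complex.ofReal_re]
    have hrow : ∑ k, ‖Q i k‖ ^ 2 = 1 := sum_row_of_mem_doublyStochastic hdsQ i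
    have h := re_sesq_ge hA hAB hε (by linarith) (x := Q i) (x' := (Q * Matrix.diagonal s) i)
      (fun α => by rw [Matrix.mul_diagonal, hsc, mul_one])
      (by rw [Matrix.mul_diagonal, hsn, mul_neg_one])
    rw [hQi, hD₁B, hD₂B, Complex.ofReal_re, Complex.ofReal_re, hrow, mul_one] at h
    simp only [hμ, hd, Pi.sub_apply, Pi.add_apply, Pi.smul_apply, Pi.one_apply, smul_eq_mul,
      mul_one]
    linarith
  obtain ⟨hin, hfle⟩ := hf.mono hΓ hmemΓ hle
  exact ⟨hin, (hf.le_of_mem_convexHull hΓ (hKΓ hl) hμmem).trans_lt (hflt.trans_le hfle)⟩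

end Cone

/-! ### Limits of eigenvalues -/

section Limits

open Polynomial Matrix

variable {n : ℕ}

/-- Compare the two sides of the eigenvector equation at the component of largest modulus. -/
theorem norm_le_of_charpoly_eq_prod {A : Matrix (Fin n) (Fin n) ℂ} {l : Fin n → ℝ} {c : ℝ}
    (hA : A.charpoly = ∏ i, (X - C (l i : ℂ))) (hc : ∀ i j, ‖A i j‖ ≤ c) (i : Fin n) :
    |l i| ≤ n * c := by
  have hdet : (Matrix.scalar (Fin n) (l i : ℂ) - A).det = 0 := by
    rw [← Matrix.eval_charpoly, hA, eval_prod]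
    exact Finset.prod_eq_zero (Finset.mem_univ i) (by simp)
  obtain ⟨v, hv, hAv⟩ := Matrix.exists_mulVec_eq_zero_iff.2 hdet
  obtain ⟨k, -, hk⟩ := Finset.exists_max_image Finset.univ (fun j => ‖v j‖) ⟨i, Finset.mem_univ i⟩
  have hvk : 0 < ‖v k‖ := by
    obtain ⟨j, hj⟩ := Function.ne_iff.1 hv
    exact (norm_pos_iff.2 hj).trans_le (hk j (Finset.mem_univ j))
  have heq : (l i : ℂ) * v k = ∑ j, A k j * v j := by
    have := congrFun hAv k
    rw [Matrix.sub_mulVec] at this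
    simp only [Matrix.scalar_apply, Pi.sub_apply, Matrix.mulVec_diagonal, Pi.zero_apply] at this
    exact sub_eq_zero.1 this
  have h1 : |l i| * ‖v k‖ ≤ n * c * ‖v k‖ := by
    calc |l i| * ‖v k‖ = ‖(l i : ℂ) * v k‖ := by rw [norm_mul, Complex.norm_real, Real.norm_eq_abs]
      _ = ‖∑ j, A k j * v j‖ := by rw [heq]
      _ ≤ ∑ j, ‖A k j * v j‖ := norm_sum_le _ _
      _ ≤ ∑ _j : Fin n, c * ‖v k‖ := Finset.sum_le_sum fun j _ => by
          rw [norm_mul]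
          exact mul_le_mul (hc k j) (hk j (Finset.mem_univ j)) (norm_nonneg _)
            ((norm_nonneg _).trans (hc k j))
      _ = n * c * ‖v k‖ := by simp [mul_assoc]
  exact le_of_mul_le_mul_right h1 hvk

/-- The eigenvalues of a convergent family of matrices converge, up to order, along an
ultrafilter. -/
theorem exists_tendsto_eigenvalues {ι : Type*} {F : Filter ι} [F.NeBot]
    {A : ι → Matrix (Fin n) (Fin n) ℂ} {A₀ : Matrix (Fin n) (Fin n) ℂ} {l : ι → Fin n → ℝ}
    {l₀ : Fin n → ℝ} (hA : Tendsto A F (𝓝 A₀))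
    (hl : ∀ᶠ t in F, (A t).charpoly = ∏ i, (X - C (l t i : ℂ)))
    (hl₀ : A₀.charpoly = ∏ i, (X - C (l₀ i : ℂ))) :
    ∃ (U : Ultrafilter ι) (σ : Equiv.Perm (Fin n)), (U : Filter ι) ≤ F ∧
      Tendsto l U (𝓝 (l₀ ∘ σ)) := by
  obtain ⟨U, hU⟩ := Ultrafilter.exists_le F
  have hentry : ∀ i j, Tendsto (fun t => A t i j) F (𝓝 (A₀ i j)) := fun i j =>
    (tendsto_pi_nhds.1 ((tendsto_pi_nhds.1 hA) i)) j
  obtain ⟨c, hc⟩ : ∃ c : ℝ, ∀ i j, ‖A₀ i j‖ < c := by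
    refine ⟨(∑ i, ∑ j, ‖A₀ i j‖) + 1, fun i j => ?_⟩
    have h1 : ‖A₀ i j‖ ≤ ∑ j, ‖A₀ i j‖ :=
      Finset.single_le_sum (fun _ _ => norm_nonneg _) (Finset.mem_univ j)
    have h2 : ∑ j, ‖A₀ i j‖ ≤ ∑ i, ∑ j, ‖A₀ i j‖ :=
      Finset.single_le_sum (f := fun i => ∑ j, ‖A₀ i j‖)
        (fun _ _ => Finset.sum_nonneg fun _ _ => norm_nonneg _) (Finset.mem_univ i)
    linarith
  have hbd : ∀ᶠ t in F, ∀ i j, ‖A t i j‖ ≤ c := by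
    rw [eventually_all]
    intro i
    rw [eventually_all]
    intro j
    filter_upwards [(hentry i j).norm.eventually (gt_mem_nhds (hc i j))] with t ht using ht.le
  have hK : IsCompact (Set.pi univ fun _ : Fin n => Icc (-(n * c)) (n * c)) :=
    isCompact_univ_pi fun _ => isCompact_Icc
  have hmem : ∀ᶠ t in F, l t ∈ Set.pi univ fun _ : Fin n => Icc (-(n * c)) (n * c) := by
    filter_upwards [hl, hbd] with t h1 h2 i _
    exact abs_le.1 (norm_le_of_charpoly_eq_prod h1 h2 i)
  -- The listings `l t` are in arbitrary order and need not converge along `F`; boundedness gives a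
  -- limit along the ultrafilter, which the characteristic polynomial then identifies up to order.
  obtain ⟨l', -, hl'⟩ := hK.ultrafilter_le_nhds (U.map l) (by
    rw [le_principal_iff]; exact hU hmem)
  have hlim : Tendsto l U (𝓝 l') := hl'
  have heq : ∏ i, (X - C (l' i : ℂ)) = ∏ i, (X - C (l₀ i : ℂ)) := by
    refine Polynomial.funext fun x => ?_
    have h1 : Tendsto (fun t => (Matrix.scalar (Fin n) x - A t).det) U
        (𝓝 (Matrix.scalar (Fin n) x - A₀).det) := by
      have hc : Continuous fun B : Matrix (Fin n) (Fin n) ℂ => (Matrix.scalar (Fin n) x - B).det :=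
        (continuous_const.sub continuous_id).matrix_det
      exact (hc.tendsto A₀).comp (hA.mono_left hU)
    have h2 : Tendsto (fun t => ∏ i, (x - (l t i : ℂ))) U (𝓝 (∏ i, (x - (l' i : ℂ)))) := by
      have hc : Continuous fun y : Fin n → ℝ => ∏ i, (x - (y i : ℂ)) := by fun_prop
      exact (hc.tendsto l').comp hlim
    have h3 : (fun t => (Matrix.scalar (Fin n) x - A t).det) =ᶠ[U]
        fun t => ∏ i, (x - (l t i : ℂ)) := by
      filter_upwards [hU hl] with t ht
      rw [← Matrix.eval_charpoly, ht, eval_prod]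
      simp
    have h4 := tendsto_nhds_unique (h1.congr' h3) h2
    rw [← Matrix.eval_charpoly, hl₀] at h4
    rw [h4, eval_prod]
    simp
  obtain ⟨σ, hσ⟩ := exists_perm_of_prod_eq heq
  exact ⟨U, σ, hU, hσ ▸ hlim⟩

end Limits

/-! ### The boundary estimate -/

theorem tendsto_matrix_inv {ι : Type*} {F : Filter ι} {n : ℕ} {G : ι → Matrix (Fin n) (Fin n) ℂ}
    {G₀ : Matrix (Fin n) (Fin n) ℂ} (hG : Tendsto G F (𝓝 G₀)) (hdet : G₀.det ≠ 0) :
    Tendsto (fun t => (G t)⁻¹) F (𝓝 G₀⁻¹) := by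
  simp only [Matrix.inv_def, Ring.inverse_eq_inv']
  exact (((continuous_id.matrix_det.tendsto G₀).comp hG).inv₀ hdet).smul
    ((continuous_id.matrix_adjugate.tendsto G₀).comp hG)

/-- Levi flatness, complex tangency and the normal may each come with a different defining function;
proportional differentials give the same complex tangent space. -/
theorem IsLocalDefiningFunction.dC_eq_zero {n : ℕ} {S : Set (CSpace n)} {z : CSpace n}
    {ρ₁ ρ₂ : CSpace n → ℝ} (h₁ : IsLocalDefiningFunction S z ρ₁)
    (h₂ : IsLocalDefiningFunction S z ρ₂) (h₁0 : ρ₁ z = 0) (h₂0 : ρ₂ z = 0) {a : CSpace n}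
    (ha : dC ρ₁ z (a, 0) = 0) : dC ρ₂ z (a, 0) = 0 := by
  obtain ⟨c, -, hc⟩ := h₁.exists_fderiv_eq_smul h₂ h₁0 h₂0
  rw [dC_eq_zero_iff] at ha ⊢
  rw [hc, hc, ha.1, ha.2, mul_zero]
  exact ⟨rfl, rfl⟩

namespace ComplexManifoldWithBoundary

variable {n : ℕ} {M : Type*} [TopologicalSpace M] {X : ComplexManifoldWithBoundary n M}

theorem isHermitian_deform {e : PartialEquiv M (CSpace n)} (χ : X.RealOneOneForm) {u : M → ℝ}
    (hu : X.IsCk 2 u) (he : e ∈ X.atlas) {z : CSpace n} (hz : z ∈ e.target) :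
    (χ.deform u e z).IsHermitian := by
  obtain ⟨ρ, hρ⟩ := X.c2_boundary e he z hz
  exact (χ.isHermitian e he z hz).add (isHermitian_complexHessian (hu e he)
    (X.uniqueDiffOn_target he) (hρ.mem_closure_interior hz) hz)

theorem continuousOn_deform {e : PartialEquiv M (CSpace n)} (χ : X.RealOneOneForm) {u : M → ℝ}
    (hu : X.IsCk 2 u) (he : e ∈ X.atlas) : ContinuousOn (χ.deform u e) e.target :=
  ContinuousOn.add (continuousOn_pi.2 fun i => continuousOn_pi.2 fun j =>
    (χ.smooth e he i j).continuousOn) (continuousOn_complexHessian (hu e he)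
      (X.uniqueDiffOn_target he))

/-- Eigenvalues at a boundary point are limits, up to order, of eigenvalues at interior points. -/
theorem exists_tendsto_inner (g : X.HermitianMetric) (χ : X.RealOneOneForm)
    {Γ : Set (Fin n → ℝ)} (hΓ : IsSymmetricCone Γ) {f : (Fin n → ℝ) → ℝ}
    (hf : IsStructureFunction Γ f) {u : M → ℝ} (hu : X.IsCk 2 u) (hadm : X.IsAdmissible g χ Γ u)
    {e : PartialEquiv M (CSpace n)} (he : e ∈ X.atlas) {p₀ : M} (hp₀ : p₀ ∈ X.boundary)
    (hp₀e : p₀ ∈ e.source) {l₀ : Fin n → ℝ} (hl₀ : l₀ ∈ Γ)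
    (hchar : ((g.coeff e (e p₀))⁻¹ * χ.deform u e (e p₀)).charpoly
      = ∏ i, (Polynomial.X - Polynomial.C (l₀ i : ℂ))) :
    ∃ (U : Ultrafilter ℝ) (p : ℝ → M) (l : ℝ → Fin n → ℝ), Tendsto p U (𝓝 p₀) ∧
      (∀ᶠ t in (U : Filter ℝ), p t ∈ X.inner ∧ l t ∈ Γ ∧ X.IsEigenvalues g χ u (p t) (l t)) ∧
      Tendsto (fun t => f (l t)) U (𝓝 (f l₀)) := by
  have hz : e p₀ ∈ e.target := e.map_source hp₀e
  have hzi := (X.mem_boundary_iff he hp₀e).1 hp₀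
  obtain ⟨ρ, hρ⟩ := X.c2_boundary e he _ hz
  have hρ0 := hρ.eq_zero_of_notMem_interior hz hzi
  obtain ⟨N, hN⟩ := hρ.exists_neg hρ0
  have hint := hρ.eventually_mem_interior hρ0 (v := N) (by rw [hN]; norm_num)
  have hline : Tendsto (fun t : ℝ => e p₀ + t • N) (𝓝[>] 0) (𝓝[e.target] (e p₀)) :=
    tendsto_nhdsWithin_iff.2 ⟨IsLocalDefiningFunction.tendsto_line _ _,
      hint.mono fun t ht => interior_subset ht⟩
  have hinner : ∀ᶠ t in 𝓝[>] (0 : ℝ), e.symm (e p₀ + t • N) ∈ X.inner := by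
    filter_upwards [hint] with t ht
    have htt := interior_subset ht
    rw [X.mem_inner_iff he (e.map_target htt), e.right_inv htt]
    exact ht
  obtain ⟨l, hl⟩ : ∃ l : ℝ → Fin n → ℝ, ∀ᶠ t in 𝓝[>] (0 : ℝ), l t ∈ Γ ∧
      X.IsEigenvalues g χ u (e.symm (e p₀ + t • N)) (l t) :=
    Filter.Eventually.choice (hinner.mono fun t ht => hadm _ ht)
  have hG : Tendsto (fun t : ℝ => g.coeff e (e p₀ + t • N)) (𝓝[>] 0) (𝓝 (g.coeff e (e p₀))) := by
    have hc : ContinuousOn (g.coeff e) e.target := continuousOn_pi.2 fun i =>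
      continuousOn_pi.2 fun j => (g.smooth e he i j).continuousOn
    exact (hc _ hz).tendsto.comp hline
  have hA : Tendsto (fun t : ℝ => (g.coeff e (e p₀ + t • N))⁻¹ * χ.deform u e (e p₀ + t • N))
      (𝓝[>] 0) (𝓝 ((g.coeff e (e p₀))⁻¹ * χ.deform u e (e p₀))) :=
    (tendsto_matrix_inv hG (g.posDef e he _ hz).det_pos.ne').mul
      ((continuousOn_deform χ hu he _ hz).tendsto.comp hline)
  have hlchar : ∀ᶠ t in 𝓝[>] (0 : ℝ),
      ((g.coeff e (e p₀ + t • N))⁻¹ * χ.deform u e (e p₀ + t • N)).charpoly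
        = ∏ i, (Polynomial.X - Polynomial.C (l t i : ℂ)) := by
    filter_upwards [hl, hint] with t ht hti
    have htt := interior_subset hti
    have := ht.2 e he (e.map_target htt)
    rwa [e.right_inv htt] at this
  obtain ⟨U, σ, hU, hlim⟩ := exists_tendsto_eigenvalues hA hlchar hchar
  refine ⟨U, fun t => e.symm (e p₀ + t • N), l, ?_, hU (hinner.and hl), ?_⟩
  · have hs := ((X.continuousOn_symm e he) _ hz).tendsto
    rw [e.left_inv hp₀e] at hs
    exact (hs.comp hline).mono_left hU
  · have hσ := hΓ.symmetric l₀ hl₀ σ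
    have hc := (hf.smooth.continuousOn.continuousAt (hΓ.isOpen.mem_nhds hσ)).tendsto.comp hlim
    rwa [hf.symmetric l₀ hl₀ σ] at hc

/-- Two functions with the same boundary values have the same complex Hessian on complex tangent
vectors of a Levi flat boundary. -/
theorem sesq_deform_eq (hX : X.IsLeviFlat) (χ : X.RealOneOneForm) {u v : M → ℝ}
    (hu : X.IsCk 2 u) (hv : X.IsCk 2 v) (huv : ∀ p ∈ X.boundary, u p = v p)
    {e : PartialEquiv M (CSpace n)} (he : e ∈ X.atlas) {p₀ : M} (hp₀ : p₀ ∈ X.boundary)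
    (hp₀e : p₀ ∈ e.source) {ρ : CSpace n → ℝ} (hρ : IsLocalDefiningFunction e.target (e p₀) ρ)
    {a b : CSpace n} (ha : dC ρ (e p₀) (a, 0) = 0) (hb : dC ρ (e p₀) (b, 0) = 0) :
    sesq (χ.deform u e (e p₀)) a b = sesq (χ.deform v e (e p₀)) a b := by
  have hz : e p₀ ∈ e.target := e.map_source hp₀e
  have hzi := (X.mem_boundary_iff he hp₀e).1 hp₀
  have hS := X.uniqueDiffOn_target he
  obtain ⟨ρ', hρ', hlevi⟩ := hX p₀ hp₀ e he hp₀e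
  have hρ0 := hρ.eq_zero_of_notMem_interior hz hzi
  have hρ'0 := hρ'.eq_zero_of_notMem_interior hz hzi
  have hzero : sesq (complexHessian (u ∘ e.symm - v ∘ e.symm) e.target (e p₀)) a b = 0 := by
    refine sesq_complexHessian_eq_zero ((hu e he).sub (hv e he)) hS hρ' hz hρ'0 ?_ ?_
      (hρ.dC_eq_zero hρ' hρ0 hρ'0 ha) (hρ.dC_eq_zero hρ' hρ0 hρ'0 hb)
    · intro w hw hwi
      have hb : e.symm w ∈ X.boundary := by
        rw [X.mem_boundary_iff he (e.map_target hw), e.right_inv hw]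
        exact hwi
      simp [huv _ hb]
    · intro c hc
      rw [← form_conj]
      refine hlevi (c, 0) ?_ hc
      simp [J]
  rw [RealOneOneForm.deform, RealOneOneForm.deform,
    complexHessian_sub (hu e he) (hv e he) hS hz, ← add_assoc, sesq_add_matrix _
      (complexHessian (u ∘ e.symm - v ∘ e.symm) e.target (e p₀)), hzero, add_zero]

/-- The inner normal is orthogonal to the complex tangent vectors. -/
theorem IsUnitInnerNormal.sesq_eq_zero {g : X.HermitianMetric} {e : PartialEquiv M (CSpace n)}
    (he : e ∈ X.atlas) {p₀ : M} (hp₀ : p₀ ∈ X.boundary) (hp₀e : p₀ ∈ e.source) {ν : CSpace n}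
    (hν : X.IsUnitInnerNormal g e p₀ ν) {ρ : CSpace n → ℝ}
    (hρ : IsLocalDefiningFunction e.target (e p₀) ρ) {a : CSpace n}
    (ha : dC ρ (e p₀) (a, 0) = 0) : sesq (g.coeff e (e p₀)) ν a = 0 := by
  have hz : e p₀ ∈ e.target := e.map_source hp₀e
  have hzi := (X.mem_boundary_iff he hp₀e).1 hp₀
  obtain ⟨ρ', hρ', -, horth, -⟩ := hν
  have ha' := (dC_eq_zero_iff _ _ _).1 (hρ.dC_eq_zero hρ'
    (hρ.eq_zero_of_notMem_interior hz hzi) (hρ'.eq_zero_of_notMem_interior hz hzi) ha)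
  -- Real orthogonality to `a` and to `i a` kills the real and imaginary parts of the Hermitian
  -- product.
  have h1 := horth _ ha'.1
  have h2 := horth _ ha'.2
  rw [HermitianMetric.tensor, form_ofReal] at h1 h2
  rw [sesq_smul_left, sesq_smul_right, Complex.star_def, Complex.conj_I] at h2
  have h3 : Complex.I * (sesq (g.coeff e (e p₀)) a ν - sesq (g.coeff e (e p₀)) ν a) = 0 := by
    linear_combination h2
  have h4 := (mul_eq_zero.1 h3).resolve_left Complex.I_ne_zero
  linear_combination (h1 - h4) / 2

end ComplexManifoldWithBoundary

end LeviFlatDirichlet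

open LeviFlatDirichlet LeviFlatDirichlet.ComplexManifoldWithBoundary in
/-- The constant `C` is chosen before `ψ`, `φ`, `u` and the subsolution `v`; it depends on `v` only
through a compact set `K ⊆ Γ` which contains the eigenvalues of `𝔤[v]`. -/
theorem proposition4p1 {n : ℕ} (hn : 2 ≤ n) {M : Type*} [TopologicalSpace M] [CompactSpace M]
    [T2Space M] (X : LeviFlatDirichlet.ComplexManifoldWithBoundary n M) (hX : X.IsLeviFlat)
    (g : X.HermitianMetric) (χ : X.RealOneOneForm)
    (Γ : Set (Fin n → ℝ)) (hΓ : LeviFlatDirichlet.IsSymmetricCone Γ)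
    (f : (Fin n → ℝ) → ℝ) (hf : LeviFlatDirichlet.IsStructureFunction Γ f)
    (K : Set (Fin n → ℝ)) (hK : IsCompact K) (hKΓ : K ⊆ Γ) :
    ∃ C : ℝ, 0 < C ∧ ∀ ψ φ v u : M → ℝ,
      Continuous ψ → 0 < LeviFlatDirichlet.delta Γ f ψ →
      X.IsSubsolution g χ Γ f ψ φ v →
      (∀ p, ∃ l ∈ K, X.IsEigenvalues g χ v p l) →
      X.IsSolution g χ Γ f ψ φ u →
      ∀ p₀ ∈ X.boundary, ∀ e ∈ X.atlas, p₀ ∈ e.source →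
      ∀ ν : LeviFlatDirichlet.CSpace n, X.IsUnitInnerNormal g e p₀ ν →
      ∀ ξn : LeviFlatDirichlet.CTangent n,
        ξn = (1 / 2 : ℂ) • (LeviFlatDirichlet.ofReal ν
          - Complex.I • LeviFlatDirichlet.J (LeviFlatDirichlet.ofReal ν)) →
      ∀ ξ : Fin (n - 1) → LeviFlatDirichlet.CTangent n,
        (∀ α, X.InComplexTangent e p₀ (ξ α)) →
        (∀ α, LeviFlatDirichlet.J (ξ α) = Complex.I • ξ α) →
        (∀ α β, g.tensor e (e p₀) (ξ α) (LeviFlatDirichlet.conjVec (ξ β))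
          = if α = β then 1 else 0) →
        (LeviFlatDirichlet.form (χ.deform u e (e p₀)) ξn
            (LeviFlatDirichlet.J (LeviFlatDirichlet.conjVec ξn))).re
          ≤ C * (1 + ∑ α, ‖LeviFlatDirichlet.form (χ.deform u e (e p₀)) (ξ α)
            (LeviFlatDirichlet.J (LeviFlatDirichlet.conjVec ξn))‖ ^ 2) := by
  obtain ⟨m, rfl⟩ : ∃ m, n = m + 1 := ⟨n - 1, by omega⟩
  obtain ⟨R, ε, hR, hε, hkey⟩ := hf.lt_of_large hΓ hK hKΓ
  -- In the unitary frame both the normal entry and the sum of squared mixed entries acquire a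
  -- factor `2` from `√2 ν`, so `R + 1 / ε` is enough to reach the threshold of `lt_of_large`.
  refine ⟨R + 1 / ε, by positivity, ?_⟩
  intro ψ φ v u hψ _ hv hvK hu p₀ hp₀ e he hp₀e ν hν ξn hξn ξ hξT hξJ hξg
  rw [half_ofReal_sub] at hξn
  subst hξn
  have hξ : ∀ α, ξ α = ((ξ α).1, 0) := fun α => eq_of_J_eq (hξJ α)
  obtain ⟨a, ha⟩ : ∃ a : Fin m → CSpace (m + 1), ∀ α, ξ α = (a α, 0) := ⟨fun α => (ξ α).1, hξ⟩
  obtain rfl : ξ = fun α => (a α, 0) := funext ha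
  have hz : e p₀ ∈ e.target := e.map_source hp₀e
  have hzi := (X.mem_boundary_iff he hp₀e).1 hp₀
  obtain ⟨ρ, hρ⟩ := X.c2_boundary e he _ hz
  have hρ0 := hρ.eq_zero_of_notMem_interior hz hzi
  have hat : ∀ α, dC ρ (e p₀) (a α, 0) = 0 := by
    intro α
    obtain ⟨ρ', hρ', hd, -⟩ := hξT α
    exact hρ'.dC_eq_zero hρ (hρ'.eq_zero_of_notMem_interior hz hzi) hρ0 hd
  have hortho : ∀ α β, sesq (g.coeff e (e p₀)) (a α) (a β) = if α = β then 1 else 0 := by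
    intro α β
    rw [← form_conj]
    exact hξg α β
  have hνa : ∀ α, sesq (g.coeff e (e p₀)) ν (a α) = 0 := fun α =>
    hν.sesq_eq_zero he hp₀ hp₀e hρ (hat α)
  have haν : ∀ α, sesq (g.coeff e (e p₀)) (a α) ν = 0 := fun α => by
    rw [← star_sesq (g.isHermitian e he _ hz), hνa, star_zero]
  have hνν : 2 * sesq (g.coeff e (e p₀)) ν ν = 1 := by
    obtain ⟨-, -, -, -, h1⟩ := hν
    rw [HermitianMetric.tensor, form_ofReal] at h1
    rw [two_mul, h1]
  have hsq : ((Real.sqrt 2 : ℝ) : ℂ) * ((Real.sqrt 2 : ℝ) : ℂ) = 2 := by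
    rw [← Complex.ofReal_mul, Real.mul_self_sqrt (by norm_num)]; norm_num
  have hstar : star ((Real.sqrt 2 : ℝ) : ℂ) = ((Real.sqrt 2 : ℝ) : ℂ) := Complex.conj_ofReal _
  -- an orthonormal frame at `p₀`
  obtain ⟨P, hPc, hPn⟩ : ∃ P : Matrix (Fin (m + 1)) (Fin (m + 1)) ℂ,
      (∀ α : Fin m, P α.castSucc = a α) ∧ P (Fin.last m) = ((Real.sqrt 2 : ℝ) : ℂ) • ν :=
    ⟨Fin.snoc (α := fun _ => CSpace (m + 1)) a (((Real.sqrt 2 : ℝ) : ℂ) • ν),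
      fun α => Fin.snoc_castSucc (α := fun _ => CSpace (m + 1)) _ _ α,
      Fin.snoc_last (α := fun _ => CSpace (m + 1)) _ _⟩
  have hP : ∀ i j, sesq (g.coeff e (e p₀)) (P i) (P j) = if i = j then 1 else 0 := by
    intro i j
    refine Fin.lastCases ?_ (fun α => ?_) i <;> refine Fin.lastCases ?_ (fun β => ?_) j
    · rw [hPn, sesq_smul_left, sesq_smul_right, hstar, ← mul_assoc, hsq, hνν, if_pos rfl]
    · rw [hPn, hPc, sesq_smul_left, hνa, mul_zero, if_neg (Fin.castSucc_lt_last β).ne']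
    · rw [hPn, hPc, sesq_smul_right, haν, mul_zero, if_neg (Fin.castSucc_lt_last α).ne]
    · rw [hPc, hPc, hortho]
      simp only [Fin.castSucc_inj]
  have hA : (P * χ.deform u e (e p₀) * P.conjTranspose).IsHermitian :=
    Matrix.isHermitian_mul_mul_conjTranspose P (isHermitian_deform χ hu.c2 he hz)
  have hB : (P * χ.deform v e (e p₀) * P.conjTranspose).IsHermitian :=
    Matrix.isHermitian_mul_mul_conjTranspose P (isHermitian_deform χ hv.c2 he hz)
  obtain ⟨l, hlK, hl⟩ := hvK p₀
  have hlchar := hl e he hp₀e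
  have huv : ∀ p ∈ X.boundary, u p = v p := fun p hp => by
    rw [hu.boundary_value p hp, hv.boundary_value p hp]
  by_contra! hlt
  simp only [form_conj] at hlt
  obtain ⟨hΓA, hflt⟩ := hkey _ _ hA hB (fun α β => by
      rw [← sesq_eq_mul, ← sesq_eq_mul, hPc, hPc]
      exact sesq_deform_eq hX χ hu.c2 hv.c2 huv he hp₀ hp₀e hρ (hat α) (hat β)) l hlK
    (by rw [← charpoly_eq_of_orthonormal _ hP, hlchar]) (by
      have hcol : ∀ α : Fin m, ‖(P * χ.deform u e (e p₀) * P.conjTranspose) α.castSucc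
          (Fin.last m)‖ ^ 2 = 2 * ‖sesq (χ.deform u e (e p₀)) (a α) ν‖ ^ 2 := by
        intro α
        rw [← sesq_eq_mul, hPc, hPn, sesq_smul_right, hstar, norm_mul, mul_pow, Complex.norm_real,
          Real.norm_eq_abs, sq_abs, Real.sq_sqrt (by norm_num)]
      have hlast : ((P * χ.deform u e (e p₀) * P.conjTranspose) (Fin.last m) (Fin.last m)).re
          = 2 * (sesq (χ.deform u e (e p₀)) ν ν).re := by
        rw [← sesq_eq_mul, hPn, sesq_smul_left, sesq_smul_right, hstar, ← mul_assoc, hsq]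
        simp
      rw [hlast, Finset.sum_congr rfl fun α _ => hcol α, ← Finset.mul_sum]
      have hs0 : 0 ≤ ∑ α : Fin m, ‖sesq (χ.deform u e (e p₀)) (a α) ν‖ ^ 2 :=
        Finset.sum_nonneg fun _ _ => sq_nonneg _
      change (R + 1 / ε) * (1 + ∑ α : Fin m, ‖sesq (χ.deform u e (e p₀)) (a α) ν‖ ^ 2) < _ at hlt
      generalize (∑ α : Fin m, ‖sesq (χ.deform u e (e p₀)) (a α) ν‖ ^ 2) = s at hs0 hlt ⊢
      have h1 : 0 ≤ R * s := by positivity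
      have h2 : 0 < 1 / ε := by positivity
      have h3 : 2 * s / ε = 2 * (1 / ε * s) := by ring
      rw [h3]
      linarith)
  have hAchar : ((g.coeff e (e p₀))⁻¹ * χ.deform u e (e p₀)).charpoly
      = ∏ i, (Polynomial.X - Polynomial.C (hA.eigenvalues i : ℂ)) := by
    rw [charpoly_eq_of_orthonormal _ hP]
    exact hA.charpoly_eq
  have hψl : ψ p₀ ≤ f l := by
    obtain ⟨U, p, l', hp, hev, hlim⟩ := exists_tendsto_inner g χ hΓ hf hv.c2 hv.admissible he hp₀
      hp₀e (hKΓ hlK) hlchar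
    exact le_of_tendsto_of_tendsto ((hψ.tendsto p₀).comp hp) hlim
      (hev.mono fun t ht => hv.inequality _ ht.1 _ ht.2.1 ht.2.2)
  -- The equation is known only in the interior; continuity of `f` at the boundary eigenvalues rests
  -- on `hΓA`, obtained from the comparison.
  have hψA : f hA.eigenvalues = ψ p₀ := by
    obtain ⟨U, p, l', hp, hev, hlim⟩ := exists_tendsto_inner g χ hΓ hf hu.c2 hu.admissible he hp₀
      hp₀e hΓA hAchar
    exact tendsto_nhds_unique hlim (((hψ.tendsto p₀).comp hp).congr'
      (hev.mono fun t ht => (hu.equation _ ht.1 _ ht.2.1 ht.2.2).symm))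
  linarith
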